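/- Let $1\le p<\infty$, $0<\theta<p$, $C_\mu\ge 1$, $C_P>0$ and $\lambda\ge 1$. There is a constant $c>0$, depending only on $p,\theta,C_\mu,C_P,\lambda$, with the following property. Let $(Y,d)$ be a locally compact metric space (for instance, under the doubling condition below, any complete one), equipped with a Borel measure $\mu$ that is doubling, i.e. $0<\mu(B(x,2r))\le C_\mu\,\mu(B(x,r))<\infty$ for all $x\in Y$ and $r>0$, where $B(x,r)$ is the open ball, and that supports a $p$-Poincaré inequality: for all $x\in Y$, $r>0$, every measurable function $u$ on $Y$ and every upper gradient $g$ of $u$, $$\frac1{\mu(B(x,r))}\int_{B(x,r)}|u-u_{B(x,r)}|\,d\mu\le C_P\, r\Big(\frac1{\mu(B(x,\lambda r))}\int_{B(x,\lambda r)}g^p\,d\mu\Big)^{1/p},\qquad u_{B}:=\frac1{\mu(B)}\int_{B}u\,d\mu.$$ Let $x_0\in Y$, $R>0$, $B_R=B(x_0,R)$, let $E,F\subset B_R$ be disjoint sets, and suppose that for some $M>0$ $$\min\{\mathcal H_R^{-\theta}(E),\mathcal H_R^{-\theta}(F)\}\ge M\,\frac{\mu(B_R)}{R^\theta},$$ where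 $\mathcal H_R^{-\theta}(A)$ is the infimum of $\sum_{i\in I}\mu(B(x_i,r_i))/r_i^\theta$ over all countable covers $A\subset\bigcup_{i\in I}B(x_i,r_i)$ with $0<r_i\le R$. Then $$\mathrm{cap}_p(E,F;B(x_0,2\lambda R))\ \ge\ c\,M\,\frac{\mu(B_R)}{R^p}.$$ Here, for an open set $U\supset E\cup F$, $\mathrm{cap}_p(E,F;U)=\inf_u\int_U g_u^p\,d\mu$, the infimum being over all functions $u$ in the Newton–Sobolev space $N^{1,p}(U,d,\mu|_U)$ with $u\ge1$ on $E$ and $u\le 0$ on $F$, and $g_u$ being the minimal $p$-weak upper gradient of $u$ in $U$. An upper gradient of $u:Y\to[-\infty,\infty]$ is a Borel function $g:Y\to[0,\infty]$ with $|u(x)-u(y)|\le\int_\gamma g\,ds$ for every non-constant compact rectifiable curve $\gamma$ with end points $x,y$ (read as $\int_\gamma g\,ds=\infty$ if $u(x)$ or $u(y)$ is infinite); it is a $p$-weak upper gradient if this holds for all such curves outside a family of $p$-modulus zero. $N^{1,p}$ consists of the measurable functions $u$ with $\int|u|^p\,d\mu<\infty$ that have a $p$-weak upper gradient in $L^p(\mu)$.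 -/

import Mathlib

open MeasureTheory Metric Set
open scoped ENNReal

noncomputable section

namespace MetricCapacity

/-- Compact curves in `Y`, parametrized by the unit interval. -/
abbrev Curve (Y : Type*) [TopologicalSpace Y] : Type _ := C(unitInterval, Y)

section Curves

variable {Y : Type*} [MetricSpace Y]

/-- The length of a curve, as its total variation. -/
def Curve.length (γ : Curve Y) : ℝ≥0∞ := eVariationOn γ univ

/-- A curve is rectifiable if its length is finite. -/
def Curve.Rectifiable (γ : Curve Y) : Prop := Curve.length γ < ⊤

/-- The curve is not constant. -/
def Curve.Nonconstant (γ : Curve Y) : Prop := ∃ s t, γ s ≠ γ t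

/-- The path integral `∫_γ g ds` of a function `g ≥ 0` along a rectifiable curve `γ`: the
integral over `[0, length γ]` of `g` composed with the arc-length parametrization of `γ`. -/
def Curve.pathIntegral (γ : Curve Y) (g : Y → ℝ≥0∞) : ℝ≥0∞ :=
  ∫⁻ t in Icc (0 : ℝ) (Curve.length γ).toReal, g (naturalParameterization γ univ 0 t)

/-- The upper gradient inequality `|u(x) - u(y)| ≤ ∫_γ g ds` for the end points `x`, `y` of the
curve `γ`; if `u(x)` or `u(y)` is not a real number, it means that `∫_γ g ds = ∞`. -/
def UpperGradientIneq (u : Y → EReal) (g : Y → ℝ≥0∞) (γ : Curve Y) : Prop :=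
  (∀ a b : ℝ, u (γ 0) = a → u (γ 1) = b →
    ENNReal.ofReal |a - b| ≤ Curve.pathIntegral γ g) ∧
  ((u (γ 0) = ⊤ ∨ u (γ 0) = ⊥ ∨ u (γ 1) = ⊤ ∨ u (γ 1) = ⊥) →
    Curve.pathIntegral γ g = ⊤)

variable [MeasurableSpace Y]

/-- `g` is an upper gradient of the extended real valued function `u`. -/
def IsUpperGradient (u : Y → EReal) (g : Y → ℝ≥0∞) : Prop :=
  Measurable g ∧
    ∀ γ : Curve Y, Curve.Rectifiable γ → Curve.Nonconstant γ → UpperGradientIneq u g γ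

/-- The `p`-modulus of a family of (compact) curves. -/
def modulus (μ : Measure Y) (p : ℝ) (Γ : Set (Curve Y)) : ℝ≥0∞ :=
  ⨅ g ∈ {g : Y → ℝ≥0∞ | Measurable g ∧
      ∀ γ ∈ Γ, Curve.Rectifiable γ → 1 ≤ Curve.pathIntegral γ g},
    ∫⁻ y, g y ^ p ∂μ

/-- `g` is a `p`-weak upper gradient of `u`: the upper gradient inequality holds for all
nonconstant rectifiable curves outside a family of `p`-modulus zero. -/
def IsWeakUpperGradient (μ : Measure Y) (p : ℝ) (u : Y → EReal) (g : Y → ℝ≥0∞) : Prop :=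
  Measurable g ∧ ∃ Γ : Set (Curve Y), modulus μ p Γ = 0 ∧
    ∀ γ : Curve Y, Curve.Rectifiable γ → Curve.Nonconstant γ → γ ∉ Γ → UpperGradientIneq u g γ

/-- The Newton-Sobolev space `N^{1,p}(Y, d, μ)`: the `μ`-measurable functions with
`∫ |u|^p dμ < ∞` that have a `p`-weak upper gradient in `L^p(μ)`. -/
def NewtonSobolev (μ : Measure Y) (p : ℝ) : Set (Y → EReal) :=
  {u | AEMeasurable u μ ∧ ∫⁻ y, (u y).abs ^ p ∂μ < ⊤ ∧
    ∃ g, IsWeakUpperGradient μ p u g ∧ ∫⁻ y, g y ^ p ∂μ < ⊤}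

/-- The energy `∫ g_u^p dμ` of the minimal `p`-weak upper gradient `g_u` of `u`. As `g_u` is the
`p`-weak upper gradient of least `L^p`-norm, this is the least value of `∫ g^p dμ` over the
`p`-weak upper gradients `g` of `u`. -/
def energy (μ : Measure Y) (p : ℝ) (u : Y → EReal) : ℝ≥0∞ :=
  ⨅ g ∈ {g : Y → ℝ≥0∞ | IsWeakUpperGradient μ p u g}, ∫⁻ y, g y ^ p ∂μ

/-- The variational `p`-capacity of the condenser `(E, F; U)`: the infimum of the energy over
the functions `u ∈ N^{1,p}(U, d, μ|_U)` on the metric measure space `U` with `u ≥ 1` on `E` and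
`u ≤ 0` on `F`. -/
def variationalCapacity (μ : Measure Y) (p : ℝ) (E F U : Set Y) : ℝ≥0∞ :=
  ⨅ u ∈ {u : U → EReal | u ∈ NewtonSobolev (μ.comap ((↑) : U → Y)) p ∧
      (∀ x : U, (x : Y) ∈ E → 1 ≤ u x) ∧ (∀ x : U, (x : Y) ∈ F → u x ≤ 0)},
    energy (μ.comap ((↑) : U → Y)) p u

/-- The Hausdorff content of codimension `θ` at scale `R`: the infimum of
`∑_{i ∈ I} μ(B(x_i, r_i)) / r_i^θ` over the countable covers of `A` by balls of radius at
most `R`. -/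
def codimHausdorffContent (μ : Measure Y) (θ R : ℝ) (A : Set Y) : ℝ≥0∞ :=
  sInf {s | ∃ (I : Set ℕ) (x : I → Y) (r : I → ℝ),
    (∀ i, 0 < r i ∧ r i ≤ R) ∧ A ⊆ ⋃ i, ball (x i) (r i) ∧
    s = ∑' i, μ (ball (x i) (r i)) / ENNReal.ofReal (r i ^ θ)}

/-- `μ` is a doubling measure with constant `C`. -/
def IsDoublingMeasure (μ : Measure Y) (C : ℝ) : Prop :=
  ∀ (x : Y) (r : ℝ), 0 < r → 0 < μ (ball x (2 * r)) ∧
    μ (ball x (2 * r)) ≤ ENNReal.ofReal C * μ (ball x r) ∧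
    ENNReal.ofReal C * μ (ball x r) < ⊤

/-- `(Y, d, μ)` supports a `p`-Poincaré inequality with constants `C` and `lam`. If `u` is not
integrable on `B(x, r)`, the left-hand side is infinite, so that the inequality then says that the
right-hand side is infinite too. -/
def SupportsPoincare (μ : Measure Y) (p C lam : ℝ) : Prop :=
  ∀ (u : Y → ℝ) (g : Y → ℝ≥0∞), AEMeasurable u μ →
    IsUpperGradient (fun y => (u y : EReal)) g →
    ∀ (x : Y) (r : ℝ), 0 < r →
      ⨍⁻ y in ball x r, ENNReal.ofReal |u y - ⨍ z in ball x r, u z ∂μ| ∂μ ≤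
        ENNReal.ofReal (C * r) * (⨍⁻ y in ball x (lam * r), g y ^ p ∂μ) ^ (1 / p)

end Curves

end MetricCapacity

end

/-! A competitor is truncated to `v` with values in `[0, 1]`. At an arbitrarily small cost in energy
its weak upper gradient is replaced by a lower semicontinuous `G`, bounded below by a positive
constant, that serves along every curve in `U` (`exists_lowerSemicontinuous_upperGradient`). Since
`E` and `F` may be null sets, Lebesgue's theorem almost everywhere gives nothing on them. The core
is a bound valid at every point `x`: `|v x - v_{B(x,r)}|` is at most a constant times the dyadic
potential of `G` at `x` (`ofReal_abs_sub_average_le`).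

To get it, `x` is joined to other points by `δ`-chains whose cost per unit length is the capped
infimum of `G` nearby, with `G` set to `∞` off a compact neighbourhood. The resulting potential
vanishes at `x`, is Lipschitz at scale `δ` and has this `G` as an upper gradient, so telescoping the
Poincaré inequality bounds its mean independently of `δ`. As `δ → 0`, compactness and lower
semicontinuity turn cheap chains into a curve (`exists_curve_of_chainDist_lt`), so these potentials
dominate `|v y - v x|` in the limit.

A dichotomy at scale `R / (8 * lam)` concludes. If the potential is large at all points of `E`, or
of `F`, then, as `θ < p`, comparison with a geometric series yields at each point a ball with large
energy, and Vitali covering bounds the content by the energy (`codimHausdorffContent_le_energy`).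
Otherwise some `x ∈ E` and `y ∈ F` have nearby means that differ by at least `1/3`, and the Poincaré
inequality on one large ball suffices (`le_energy_of_average`), because `M ≤ 1`. -/

noncomputable section

namespace MetricCapacity

open Filter Topology
open scoped NNReal

/-! ### Arc length and path integrals. -/

section ArcLength

variable {Y : Type*} [MetricSpace Y]

/-- The arc-length function of a curve. -/
def Curve.arc (γ : Curve Y) (t : unitInterval) : ℝ := variationOnFromTo γ univ 0 t

theorem Curve.Rectifiable.boundedVariationOn {γ : Curve Y} (hγ : γ.Rectifiable) :
    BoundedVariationOn γ univ := hγ.ne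

theorem Curve.Rectifiable.locallyBV {γ : Curve Y} (hγ : γ.Rectifiable) :
    LocallyBoundedVariationOn γ univ := hγ.boundedVariationOn.locallyBoundedVariationOn

theorem Curve.arc_zero (γ : Curve Y) : γ.arc 0 = 0 := variationOnFromTo.self _ _ _

theorem Curve.arc_one (γ : Curve Y) : γ.arc 1 = γ.length.toReal := by
  rw [Curve.arc, variationOnFromTo.eq_of_le _ _ zero_le_one, Curve.length]
  congr 2
  ext t
  simpa using unitInterval.le_one'

theorem Curve.Rectifiable.arc_monotone {γ : Curve Y} (hγ : γ.Rectifiable) : Monotone γ.arc :=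
  fun _ _ h => variationOnFromTo.monotoneOn hγ.locallyBV (mem_univ _) (mem_univ _) (mem_univ _) h

/-- The one-sided limits of the variation function differ from its value by the jump of the curve,
which is zero. -/
theorem Curve.Rectifiable.arc_continuous {γ : Curve Y} (hγ : γ.Rectifiable) :
    Continuous γ.arc := by
  rw [continuous_iff_continuousAt]
  intro b
  rw [continuousAt_iff_continuous_left'_right']
  have hc : Tendsto γ (𝓝 b) (𝓝 (γ b)) := γ.continuous.tendsto b
  constructor
  · have h := variationOnFromTo.tendsto_left (f := γ) (s := univ) (a := 0) (b := b) (l := γ b)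
      (mem_univ _) (mem_univ _) hγ.locallyBV (hc.mono_left nhdsWithin_le_nhds)
    rw [dist_self, sub_zero, univ_inter] at h
    exact h
  · have h := variationOnFromTo.tendsto_right (f := γ) (s := univ) (a := 0) (b := b) (l := γ b)
      (mem_univ _) (mem_univ _) hγ.locallyBV (hc.mono_left nhdsWithin_le_nhds)
    rw [dist_self, add_zero, univ_inter] at h
    exact h

theorem Curve.Rectifiable.arc_mem {γ : Curve Y} (hγ : γ.Rectifiable) (t : unitInterval) :
    γ.arc t ∈ Icc 0 γ.length.toReal := by
  rw [← γ.arc_one]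
  nth_rewrite 1 [← γ.arc_zero]
  exact ⟨hγ.arc_monotone t.2.1, hγ.arc_monotone t.2.2⟩

theorem Curve.Rectifiable.exists_arc_eq {γ : Curve Y} (hγ : γ.Rectifiable) {s : ℝ}
    (hs : s ∈ Icc 0 γ.length.toReal) : ∃ t, γ.arc t = s := by
  rw [← γ.arc_one, ← γ.arc_zero] at hs
  exact mem_range_of_exists_le_of_exists_ge hγ.arc_continuous ⟨_, hs.1⟩ ⟨_, hs.2⟩

/-- The arc-length parametrization of a curve. -/
def Curve.nat (γ : Curve Y) : ℝ → Y := naturalParameterization γ univ 0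

theorem Curve.Rectifiable.nat_arc {γ : Curve Y} (hγ : γ.Rectifiable) (t : unitInterval) :
    γ.nat (γ.arc t) = γ t :=
  edist_eq_zero.1 (edist_naturalParameterization_eq_zero hγ.locallyBV (mem_univ _) (mem_univ _))

theorem Curve.Rectifiable.dist_le_arc {γ : Curve Y} (hγ : γ.Rectifiable) {s t : unitInterval}
    (h : s ≤ t) : dist (γ s) (γ t) ≤ γ.arc t - γ.arc s := by
  have h1 : γ.arc t - γ.arc s = variationOnFromTo γ univ s t :=
    variationOnFromTo.sub_right hγ.locallyBV (mem_univ _) (mem_univ _) (mem_univ _)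
  rw [h1, variationOnFromTo.eq_of_le _ _ h, dist_edist]
  exact ENNReal.toReal_mono (hγ.locallyBV _ _ (mem_univ _) (mem_univ _))
    (eVariationOn.edist_le _ ⟨mem_univ _, le_rfl, h⟩ ⟨mem_univ _, h, le_rfl⟩)

theorem Curve.Rectifiable.nat_lipschitzOn {γ : Curve Y} (hγ : γ.Rectifiable) :
    LipschitzOnWith 1 γ.nat (Icc 0 γ.length.toReal) := by
  apply LipschitzOnWith.of_dist_le_mul
  have key : ∀ x ∈ Icc 0 γ.length.toReal, ∀ y ∈ Icc 0 γ.length.toReal, x ≤ y →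
      dist (γ.nat x) (γ.nat y) ≤ y - x := by
    intro x hx y hy hxy
    obtain ⟨s, rfl⟩ := hγ.exists_arc_eq hx
    obtain ⟨t, rfl⟩ := hγ.exists_arc_eq hy
    rw [hγ.nat_arc, hγ.nat_arc]
    rcases le_total s t with h | h
    · exact hγ.dist_le_arc h
    · have h2 := hγ.dist_le_arc h
      rw [dist_comm]
      have h3 := hγ.arc_monotone h
      linarith
  intro x hx y hy
  rw [NNReal.coe_one, one_mul, Real.dist_eq]
  rcases le_total x y with h | h
  · rw [abs_sub_comm]; exact (key x hx y hy h).trans (le_abs_self _)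
  · rw [dist_comm]; exact (key y hy x hx h).trans (le_abs_self _)

theorem Curve.nat_zero {γ : Curve Y} (hγ : γ.Rectifiable) : γ.nat 0 = γ 0 := by
  conv_lhs => rw [← γ.arc_zero, hγ.nat_arc]

theorem Curve.nat_length {γ : Curve Y} (hγ : γ.Rectifiable) :
    γ.nat γ.length.toReal = γ 1 := by
  rw [← γ.arc_one, hγ.nat_arc]

theorem Curve.Rectifiable.length_pos {γ : Curve Y} (hγ : γ.Rectifiable) (h : γ.Nonconstant) :
    0 < γ.length.toReal := by
  obtain ⟨s, t, hst⟩ := h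
  apply ENNReal.toReal_pos _ hγ.ne
  intro h0
  exact hst (edist_eq_zero.1 ((eVariationOn.eq_zero_iff γ).1 h0 s (mem_univ _) t (mem_univ _)))

theorem Curve.Rectifiable.nat_mem {γ : Curve Y} (hγ : γ.Rectifiable) {K : Set Y}
    (hK : ∀ t, γ t ∈ K) {s : ℝ} (hs : s ∈ Icc 0 γ.length.toReal) : γ.nat s ∈ K := by
  obtain ⟨t, rfl⟩ := hγ.exists_arc_eq hs
  rw [hγ.nat_arc]; exact hK t

theorem Curve.pathIntegral_mono {γ : Curve Y} (hγ : γ.Rectifiable) {K : Set Y}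
    (hK : ∀ t, γ t ∈ K) {g h : Y → ℝ≥0∞} (hgh : ∀ y ∈ K, g y ≤ h y) :
    γ.pathIntegral g ≤ γ.pathIntegral h :=
  setLIntegral_mono' measurableSet_Icc fun _ hs => hgh _ (hγ.nat_mem hK hs)

/-- A curve leaving a closed set spends positive time outside of it. -/
theorem Curve.pathIntegral_eq_top {γ : Curve Y} (hγ : γ.Rectifiable) (hn : γ.Nonconstant)
    {K : Set Y} (hK : IsClosed K) {g : Y → ℝ≥0∞} (hg : ∀ y ∉ K, g y = ⊤)
    (hleave : ∃ t, γ t ∉ K) : γ.pathIntegral g = ⊤ := by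
  obtain ⟨t, ht⟩ := hleave
  set ℓ := γ.length.toReal with hℓ
  have hpos : 0 < ℓ := hγ.length_pos hn
  have hs := hγ.arc_mem t
  rw [← hγ.nat_arc] at ht
  set s := γ.arc t
  have hc : ContinuousWithinAt γ.nat (Icc 0 ℓ) s := hγ.nat_lipschitzOn.continuousOn s hs
  have hev : γ.nat ⁻¹' Kᶜ ∈ 𝓝[Icc 0 ℓ] s := hc (hK.isOpen_compl.mem_nhds ht)
  obtain ⟨ε, hε, hball⟩ := Metric.mem_nhdsWithin_iff.1 hev
  -- a nondegenerate interval contained in the intersection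
  set a := max 0 (s - ε)
  set b := min ℓ (s + ε)
  have hab : a < b := by
    simp only [a, b, max_lt_iff, lt_min_iff]
    have hs1 := hs.1
    have hs2 := hs.2
    exact ⟨⟨hpos, by linarith⟩, by linarith, by linarith⟩
  have hsub : Ioo a b ⊆ Icc 0 ℓ ∩ γ.nat ⁻¹' Kᶜ := by
    intro z hz
    have hz1 := hz.1
    have hz2 := hz.2
    simp only [a, b, max_lt_iff, lt_min_iff] at hz1 hz2
    have hzI : z ∈ Icc 0 ℓ := ⟨hz1.1.le, hz2.1.le⟩
    refine ⟨hzI, hball ⟨?_, hzI⟩⟩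
    rw [Metric.mem_ball, Real.dist_eq, abs_lt]
    constructor <;> linarith
  rw [eq_top_iff]
  calc (⊤ : ℝ≥0∞) = ∫⁻ _ in Ioo a b, ⊤ := by
        simp [hab]
    _ ≤ ∫⁻ z in Ioo a b, g (γ.nat z) := by
        refine setLIntegral_mono' measurableSet_Ioo fun z hz => ?_
        rw [hg _ (hsub hz).2]
    _ ≤ γ.pathIntegral g := lintegral_mono_set fun z hz => (hsub hz).1

/-- The path integral is dominated by the integral along any Lipschitz parametrization. -/
theorem Curve.pathIntegral_le_lipschitz {γ : Curve Y} (ℓ : ℝ≥0)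
    (hL : ∀ s t : unitInterval, dist (γ s) (γ t) ≤ ℓ * |(s : ℝ) - t|) :
    γ.Rectifiable ∧ ∀ g : Y → ℝ≥0∞,
      γ.pathIntegral g ≤ ℓ * ∫⁻ t in Icc (0 : ℝ) 1, g (γ (projIcc 0 1 zero_le_one t)) := by
  have hlip : LipschitzWith ℓ γ := LipschitzWith.of_dist_le_mul fun s t => by
    simpa [Subtype.dist_eq, Real.dist_eq] using hL s t
  have hvar : ∀ s t : unitInterval, s ≤ t →
      eVariationOn γ (univ ∩ Icc s t) ≤ ENNReal.ofReal (ℓ * (t - s : ℝ)) := by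
    intro s t hst
    have h1 := (hlip.lipschitzOnWith (s := univ)).comp_eVariationOn_le (f := γ)
      (g := (id : unitInterval → unitInterval)) (s := Icc s t) (mapsTo_univ _ _)
    have h2 : eVariationOn (id : unitInterval → unitInterval) (Icc s t)
        = eVariationOn (fun x : unitInterval => (x : ℝ)) (Icc s t) := by
      simp only [eVariationOn, Subtype.edist_eq, id]
    have h3 : eVariationOn (fun x : unitInterval => (x : ℝ)) (Icc s t) ≤
        ENNReal.ofReal ((t : ℝ) - s) := by
      have := (MonotoneOn.eVariationOn_eq (f := fun x : unitInterval => (x : ℝ))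
        (s := Icc s t) (fun a _ b _ h => h) (left_mem_Icc.2 hst) (right_mem_Icc.2 hst)).le
      simpa using this
    rw [univ_inter]
    calc eVariationOn γ (Icc s t) ≤ ℓ * eVariationOn (id : unitInterval → unitInterval) (Icc s t) :=
          h1
      _ ≤ ℓ * ENNReal.ofReal ((t : ℝ) - s) := by rw [h2]; gcongr
      _ = _ := by rw [ENNReal.ofReal_mul ℓ.coe_nonneg, ENNReal.ofReal_coe_nnreal]
  have hrect : γ.Rectifiable := by
    have := hvar 0 1 zero_le_one
    have h2 : (univ ∩ Icc 0 1 : Set unitInterval) = univ := by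
      ext t; simpa using unitInterval.le_one'
    rw [h2] at this
    exact this.trans_lt ENNReal.ofReal_lt_top
  refine ⟨hrect, fun g => ?_⟩
  have harc : ∀ s t : unitInterval, s ≤ t → γ.arc t - γ.arc s ≤ ℓ * (t - s : ℝ) := by
    intro s t hst
    have h1 : γ.arc t - γ.arc s = variationOnFromTo γ univ s t :=
      variationOnFromTo.sub_right hrect.locallyBV (mem_univ _) (mem_univ _) (mem_univ _)
    rw [h1, variationOnFromTo.eq_of_le _ _ hst]
    exact ENNReal.toReal_le_of_le_ofReal (mul_nonneg ℓ.2 (sub_nonneg.2 hst)) (hvar s t hst)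
  set S : ℝ → ℝ := fun t => γ.arc (projIcc 0 1 zero_le_one t) with hS
  have hSc : Continuous S := hrect.arc_continuous.comp continuous_projIcc
  have hSlip : LipschitzOnWith ℓ S (Icc 0 1) := by
    apply LipschitzOnWith.of_dist_le_mul
    have key : ∀ x ∈ Icc (0 : ℝ) 1, ∀ y ∈ Icc (0 : ℝ) 1, x ≤ y → |S y - S x| ≤ ℓ * (y - x) := by
      intro x hx y hy hxy
      have hm : projIcc (0 : ℝ) 1 zero_le_one x ≤ projIcc 0 1 zero_le_one y :=
        monotone_projIcc _ hxy
      rw [abs_of_nonneg (sub_nonneg.2 (hrect.arc_monotone hm))]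
      have := harc _ _ hm
      rwa [projIcc_of_mem _ hx, projIcc_of_mem _ hy] at this ⊢
    intro x hx y hy
    rw [Real.dist_eq, Real.dist_eq]
    rcases le_total x y with h | h
    · rw [abs_sub_comm, abs_sub_comm x, abs_of_nonneg (sub_nonneg.2 h)]; exact key x hx y hy h
    · rw [abs_of_nonneg (sub_nonneg.2 h)]; exact key y hy x hx h
  -- `S` maps `[0, 1]` onto `[0, length]` and is `ℓ`-Lipschitz, so it expands one-dimensional
  -- Hausdorff measure at most by `ℓ`.
  have hmeas : (volume.restrict (Icc 0 γ.length.toReal) : Measure ℝ) ≤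
      (ℓ : ℝ≥0∞) • (volume.restrict (Icc (0 : ℝ) 1)).map S := by
    refine Measure.le_iff.2 fun B hB => ?_
    rw [Measure.restrict_apply hB, Measure.smul_apply, Measure.map_apply hSc.measurable hB,
      Measure.restrict_apply (hSc.measurable hB), smul_eq_mul]
    have hsub : B ∩ Icc 0 γ.length.toReal ⊆ S '' (S ⁻¹' B ∩ Icc 0 1) := by
      rintro s ⟨hsB, hs⟩
      obtain ⟨t, rfl⟩ := hrect.exists_arc_eq hs
      have : S t = γ.arc t := by simp [hS]
      exact ⟨t, ⟨by rwa [mem_preimage, this], t.2⟩, this⟩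
    have h1 := (hSlip.mono (inter_subset_right (s := S ⁻¹' B))).hausdorffMeasure_image_le
      (zero_le_one : (0 : ℝ) ≤ 1)
    rw [hausdorffMeasure_real] at h1
    exact (measure_mono hsub).trans (by simpa using h1)
  calc γ.pathIntegral g = ∫⁻ s in Icc 0 γ.length.toReal, g (γ.nat s) := rfl
    _ ≤ ∫⁻ s, g (γ.nat s) ∂((ℓ : ℝ≥0∞) • (volume.restrict (Icc (0 : ℝ) 1)).map S) :=
        lintegral_mono' hmeas le_rfl
    _ = ℓ * ∫⁻ s, g (γ.nat s) ∂((volume.restrict (Icc (0 : ℝ) 1)).map S) := by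
        rw [lintegral_smul_measure, smul_eq_mul]
    _ ≤ ℓ * ∫⁻ t in Icc (0 : ℝ) 1, g (γ.nat (S t)) := by
        exact mul_le_mul_right (lintegral_map_le _ _) _
    _ = _ := by simp only [hS, hrect.nat_arc]

end ArcLength

/-! ### Chain distances and their potentials. -/

section Chains

variable {Y : Type*} [MetricSpace Y]

/-- The cost per unit length of a step of a `δ`-chain starting at `a`: the infimum of `g` near `a`,
truncated at `1 / δ`. -/
def infCost (g : Y → ℝ≥0∞) (δ : ℝ) (a : Y) : ℝ≥0∞ :=
  min (ENNReal.ofReal δ⁻¹) (⨅ z ∈ ball a δ, g z)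

theorem infCost_le (g : Y → ℝ≥0∞) {δ : ℝ} {a z : Y} (h : dist z a < δ) : infCost g δ a ≤ g z :=
  (min_le_right _ _).trans (biInf_le _ (mem_ball.2 h))

/-- The smaller ball lies in the larger one, and the cap `1 / δ` grows as `δ` shrinks. This compares
a fixed scale with finer scales at nearby points. -/
theorem infCost_anti (g : Y → ℝ≥0∞) {δ δ' : ℝ} (hδ : 0 < δ) {a b : Y}
    (h : δ + dist a b ≤ δ') : infCost g δ' b ≤ infCost g δ a := by
  refine min_le_min (ENNReal.ofReal_le_ofReal (inv_anti₀ hδ ?_)) ?_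
  · linarith [dist_nonneg (x := a) (y := b)]
  · refine biInf_mono fun z hz => ?_
    rw [mem_ball] at hz ⊢
    linarith [dist_triangle z a b]

/-- The points `c 0 = x, c 1, …, c n = y` form a `δ`-chain in `K`. -/
structure IsDeltaChain (K : Set Y) (δ : ℝ) (x y : Y) (c : ℕ → Y) (n : ℕ) : Prop where
  start : c 0 = x
  finish : c n = y
  mem : ∀ i ≤ n, c i ∈ K
  step : ∀ i < n, dist (c i) (c (i + 1)) < δ

/-- The cost of a chain. -/
def chainCost (g : Y → ℝ≥0∞) (δ : ℝ) (c : ℕ → Y) (n : ℕ) : ℝ≥0∞ :=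
  ∑ i ∈ Finset.range n, infCost g δ (c i) * edist (c i) (c (i + 1))

/-- The least cost of a `δ`-chain in `K` from `x` to `y`. -/
def chainDist (K : Set Y) (g : Y → ℝ≥0∞) (δ : ℝ) (x y : Y) : ℝ≥0∞ :=
  ⨅ (c : ℕ → Y) (n : ℕ) (_ : IsDeltaChain K δ x y c n), chainCost g δ c n

theorem chainDist_le {K : Set Y} {g : Y → ℝ≥0∞} {δ : ℝ} {x y : Y} {c : ℕ → Y} {n : ℕ}
    (h : IsDeltaChain K δ x y c n) : chainDist K g δ x y ≤ chainCost g δ c n :=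
  iInf_le_of_le c (iInf_le_of_le n (iInf_le _ h))

theorem exists_chain_of_chainDist_lt {K : Set Y} {g : Y → ℝ≥0∞} {δ : ℝ} {x y : Y} {L : ℝ≥0∞}
    (h : chainDist K g δ x y < L) :
    ∃ c n, IsDeltaChain K δ x y c n ∧ chainCost g δ c n < L := by
  simp only [chainDist, iInf_lt_iff] at h
  obtain ⟨c, n, hc, h⟩ := h
  exact ⟨c, n, hc, h⟩

theorem chainDist_self {K : Set Y} (g : Y → ℝ≥0∞) (δ : ℝ) {x : Y} (hx : x ∈ K) :
    chainDist K g δ x x = 0 := by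
  have h : IsDeltaChain K δ x x (fun _ => x) 0 := ⟨rfl, rfl, fun _ _ => hx, fun i hi => by omega⟩
  simpa [chainCost] using chainDist_le (g := g) h

theorem chainDist_of_notMem {K : Set Y} (g : Y → ℝ≥0∞) (δ : ℝ) {x y : Y} (hy : y ∉ K) :
    chainDist K g δ x y = ⊤ := by
  by_contra h
  obtain ⟨c, n, hc, -⟩ := exists_chain_of_chainDist_lt (lt_top_iff_ne_top.2 h)
  exact hy (hc.finish ▸ hc.mem n le_rfl)

/-- Append `b` to a nearly optimal chain. Used in both directions, this controls the oscillation of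
the chain distance. -/
theorem chainDist_step {K : Set Y} (g : Y → ℝ≥0∞) {δ : ℝ} (x : Y) {a b : Y}
    (hb : b ∈ K) (hab : dist a b < δ) :
    chainDist K g δ x b ≤ chainDist K g δ x a + infCost g δ a * edist a b := by
  refine le_of_forall_gt fun L hL => ?_
  obtain ⟨L', hL', hLL⟩ : ∃ L', chainDist K g δ x a < L' ∧
      L' + infCost g δ a * edist a b < L := by
    have hfin : infCost g δ a * edist a b ≠ ⊤ :=
      ENNReal.mul_ne_top ((min_le_left _ _).trans_lt ENNReal.ofReal_lt_top).ne (edist_ne_top _ _)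
    have h2 : chainDist K g δ x a < L - infCost g δ a * edist a b :=
      lt_tsub_iff_right.2 hL
    obtain ⟨L', h3, h4⟩ := exists_between h2
    exact ⟨L', h3, lt_tsub_iff_right.1 h4⟩
  obtain ⟨c, n, hc, hcost⟩ := exists_chain_of_chainDist_lt hL'
  have hc' : IsDeltaChain K δ x b (fun i => if i ≤ n then c i else b) (n + 1) := by
    refine ⟨by simp [hc.start], by simp, fun i hi => ?_, fun i hi => ?_⟩
    · split_ifs with h
      · exact hc.mem i h
      · exact hb
    · rw [if_pos (by omega)]
      split_ifs with h
      · exact hc.step i (by omega)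
      · obtain rfl : i = n := by omega
        rwa [hc.finish]
  refine (chainDist_le hc').trans_lt (lt_of_le_of_lt ?_ hLL)
  rw [chainCost, Finset.sum_range_succ]
  refine add_le_add (le_trans (le_of_eq ?_) hcost.le) (by simp [hc.finish])
  refine Finset.sum_congr rfl fun i hi => ?_
  have := Finset.mem_range.1 hi
  rw [if_pos (by omega), if_pos (by omega)]

theorem chainDist_anti (K : Set Y) (g : Y → ℝ≥0∞) {δ δ' : ℝ} (hδ : 0 < δ) (h : δ ≤ δ') (x y : Y) :
    chainDist K g δ' x y ≤ chainDist K g δ x y := by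
  refine le_iInf fun c => le_iInf fun n => le_iInf fun hc => ?_
  have hc' : IsDeltaChain K δ' x y c n :=
    ⟨hc.start, hc.finish, hc.mem, fun i hi => (hc.step i hi).trans_le h⟩
  refine (chainDist_le hc').trans ?_
  refine Finset.sum_le_sum fun i _ => ?_
  gcongr
  exact infCost_anti g hδ (by simpa using h)

/-- All points of the piece lie within `δ` of `σ e`, so the cost is below `g` there. With `e` free,
either end can be the base point, as steps in both directions require. -/
theorem infCost_mul_edist_le {g : Y → ℝ≥0∞} {δ : ℝ} {σ : ℝ → Y} {ℓ a b e : ℝ}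
    (hσ : LipschitzOnWith 1 σ (Icc 0 ℓ)) (ha : 0 ≤ a) (hab : a ≤ b) (hb : b ≤ ℓ) (hδ : b - a < δ)
    (he : e ∈ Icc a b) :
    infCost g δ (σ e) * edist (σ a) (σ b) ≤ ∫⁻ s in Ioc a b, g (σ s) := by
  have hd : ∀ s ∈ Icc a b, ∀ t ∈ Icc a b, dist (σ s) (σ t) ≤ |s - t| := by
    intro s hs t ht
    simpa [Real.dist_eq] using hσ.dist_le_mul s ⟨ha.trans hs.1, hs.2.trans hb⟩ t
      ⟨ha.trans ht.1, ht.2.trans hb⟩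
  have h1 : edist (σ a) (σ b) ≤ ENNReal.ofReal (b - a) := by
    rw [edist_dist]
    refine ENNReal.ofReal_le_ofReal ((hd a ⟨le_rfl, hab⟩ b ⟨hab, le_rfl⟩).trans ?_)
    rw [abs_sub_comm, abs_of_nonneg (sub_nonneg.2 hab)]
  calc infCost g δ (σ e) * edist (σ a) (σ b)
      ≤ infCost g δ (σ e) * ENNReal.ofReal (b - a) := by gcongr
    _ = ∫⁻ _ in Ioc a b, infCost g δ (σ e) := by simp
    _ ≤ _ := by
        refine setLIntegral_mono' measurableSet_Ioc fun s hs => infCost_le g ?_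
        refine (hd s (Ioc_subset_Icc_self hs) e he).trans_lt (lt_of_le_of_lt ?_ hδ)
        rw [abs_le]
        constructor <;> linarith [hs.1, hs.2, he.1, he.2]

/-- A function whose oscillation over short distances is controlled by `infCost g` has `g` as an
upper gradient. -/
theorem le_add_lintegral_of_step {K : Set Y} {g : Y → ℝ≥0∞} {δ : ℝ} (hδ : 0 < δ) {w : Y → ℝ≥0∞}
    (hw : ∀ a ∈ K, ∀ b ∈ K, dist a b < δ → w b ≤ w a + infCost g δ a * edist a b)
    {σ : ℝ → Y} {ℓ : ℝ} (hℓ : 0 ≤ ℓ) (hσ : LipschitzOnWith 1 σ (Icc 0 ℓ))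
    (hK : ∀ s ∈ Icc 0 ℓ, σ s ∈ K) :
    w (σ ℓ) ≤ w (σ 0) + ∫⁻ s in Icc 0 ℓ, g (σ s) ∧
      w (σ 0) ≤ w (σ ℓ) + ∫⁻ s in Icc 0 ℓ, g (σ s) := by
  obtain ⟨N, hN⟩ := exists_nat_gt (ℓ / δ)
  -- Pieces of arc length below `δ`, so that `hw` applies to consecutive points.
  set h := ℓ / (N + 1) with hh
  have hN1 : (0 : ℝ) < N + 1 := by positivity
  have hh0 : 0 ≤ h := by positivity
  have hhδ : h < δ := by
    rw [hh, div_lt_iff₀ hN1]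
    rw [div_lt_iff₀ hδ] at hN
    nlinarith
  have hNh : ((N + 1 : ℕ) : ℝ) * h = ℓ := by
    rw [hh]; push_cast; field_simp
  have main : ∀ k : ℕ, k ≤ N + 1 →
      w (σ (k * h)) ≤ w (σ 0) + ∫⁻ s in Ioc 0 (k * h), g (σ s) ∧
      w (σ 0) ≤ w (σ (k * h)) + ∫⁻ s in Ioc 0 (k * h), g (σ s) := by
    intro k
    induction k with
    | zero => intro _; simp
    | succ k ih =>
      intro hk
      obtain ⟨ih1, ih2⟩ := ih (by omega)
      have hk0 : (0 : ℝ) ≤ k * h := by positivity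
      have hkk : (k : ℝ) * h ≤ (k + 1 : ℕ) * h := by push_cast; nlinarith
      have hkl : ((k + 1 : ℕ) : ℝ) * h ≤ ℓ := by
        rw [← hNh]
        exact mul_le_mul_of_nonneg_right (by exact_mod_cast hk) hh0
      have hkd : ((k + 1 : ℕ) : ℝ) * h - k * h < δ := by push_cast; linarith
      have hsplit : ∫⁻ s in Ioc 0 (((k + 1 : ℕ) : ℝ) * h), g (σ s) =
          (∫⁻ s in Ioc 0 (k * h), g (σ s)) +
            ∫⁻ s in Ioc (k * h) (((k + 1 : ℕ) : ℝ) * h), g (σ s) := by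
        rw [← lintegral_union measurableSet_Ioc (Ioc_disjoint_Ioc_of_le le_rfl),
          Ioc_union_Ioc_eq_Ioc hk0 hkk]
      have ma := hK (k * h) ⟨hk0, hkk.trans hkl⟩
      have mb := hK ((k + 1 : ℕ) * h) ⟨hk0.trans hkk, hkl⟩
      have hd : dist (σ (k * h)) (σ ((k + 1 : ℕ) * h)) < δ := by
        refine (hσ.dist_le_mul _ ⟨hk0, hkk.trans hkl⟩ _ ⟨hk0.trans hkk, hkl⟩).trans_lt ?_
        rw [NNReal.coe_one, one_mul, Real.dist_eq, abs_sub_comm, abs_of_nonneg (sub_nonneg.2 hkk)]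
        exact hkd
      have s1 := (hw _ ma _ mb hd).trans (add_le_add_right
        (infCost_mul_edist_le hσ hk0 hkk hkl hkd (left_mem_Icc.2 hkk)) _)
      have s2 := hw _ mb _ ma (by rwa [dist_comm])
      rw [edist_comm] at s2
      replace s2 := s2.trans (add_le_add_right
        (infCost_mul_edist_le hσ hk0 hkk hkl hkd (right_mem_Icc.2 hkk)) _)
      rw [hsplit]
      constructor
      · refine s1.trans ((add_le_add_left ih1 _).trans (le_of_eq ?_))
        rw [add_assoc]
      · refine ih2.trans ((add_le_add_left s2 _).trans (le_of_eq ?_))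
        rw [add_assoc, add_comm (∫⁻ s in Ioc (k * h) _, g (σ s))]
  have := main (N + 1) le_rfl
  rw [hNh] at this
  have hm : ∫⁻ s in Ioc 0 ℓ, g (σ s) ≤ ∫⁻ s in Icc 0 ℓ, g (σ s) :=
    lintegral_mono_set Ioc_subset_Icc_self
  exact ⟨this.1.trans (add_le_add_right hm _), this.2.trans (add_le_add_right hm _)⟩

/-- The chain distance truncated at `1`, as a real function. -/
def chainPotential (K : Set Y) (g : Y → ℝ≥0∞) (δ : ℝ) (x y : Y) : ℝ :=
  (min 1 (chainDist K g δ x y)).toReal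

theorem ofReal_chainPotential (K : Set Y) (g : Y → ℝ≥0∞) (δ : ℝ) (x y : Y) :
    ENNReal.ofReal (chainPotential K g δ x y) = min 1 (chainDist K g δ x y) :=
  ENNReal.ofReal_toReal ((min_le_left _ _).trans_lt ENNReal.one_lt_top).ne

theorem chainPotential_nonneg (K : Set Y) (g : Y → ℝ≥0∞) (δ : ℝ) (x y : Y) :
    0 ≤ chainPotential K g δ x y := ENNReal.toReal_nonneg

theorem chainPotential_le_one (K : Set Y) (g : Y → ℝ≥0∞) (δ : ℝ) (x y : Y) :
    chainPotential K g δ x y ≤ 1 :=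
  ENNReal.toReal_le_of_le_ofReal zero_le_one (by simp)

theorem chainPotential_self {K : Set Y} (g : Y → ℝ≥0∞) (δ : ℝ) {x : Y} (hx : x ∈ K) :
    chainPotential K g δ x x = 0 := by
  simp [chainPotential, chainDist_self g δ hx]

theorem ofReal_abs_sub_toReal_min_le {a b I : ℝ≥0∞} (h1 : a ≤ b + I) (h2 : b ≤ a + I) :
    ENNReal.ofReal |(min 1 a).toReal - (min 1 b).toReal| ≤ I := by
  rcases eq_or_ne I ⊤ with rfl | hI
  · exact le_top
  have key : ∀ a b : ℝ≥0∞, a ≤ b + I → (min 1 a).toReal - (min 1 b).toReal ≤ I.toReal := by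
    intro a b h
    have h3 : min 1 a ≤ min 1 b + I := by
      rcases le_total 1 b with h | h
      · rw [min_eq_left h]; exact (min_le_left _ _).trans le_self_add
      · rw [min_eq_right h]; exact (min_le_right _ _).trans ‹_›
    have hf : ∀ b : ℝ≥0∞, min 1 b ≠ ⊤ := fun b =>
      ((min_le_left _ _).trans_lt ENNReal.one_lt_top).ne
    have h4 := ENNReal.toReal_mono (ENNReal.add_ne_top.2 ⟨hf b, hI⟩) h3
    rw [ENNReal.toReal_add (hf b) hI] at h4
    linarith
  refine ENNReal.ofReal_le_of_le_toReal (abs_le.2 ⟨?_, key a b h1⟩)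
  linarith [key b a h2]

/-- The cap `1 / δ` on the cost gives this bound whatever `g` is. -/
theorem chainPotential_sub_le {K : Set Y} (g : Y → ℝ≥0∞) {δ : ℝ} (hδ : 0 < δ) (x : Y) {a b : Y}
    (ha : a ∈ K) (hb : b ∈ K) (hab : dist a b < δ) :
    |chainPotential K g δ x a - chainPotential K g δ x b| ≤ δ⁻¹ * dist a b := by
  have key : ∀ a ∈ K, ∀ b ∈ K, dist a b < δ → chainDist K g δ x a ≤
      chainDist K g δ x b + ENNReal.ofReal (δ⁻¹ * dist a b) := by
    intro a ha b hb hab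
    rw [dist_comm] at hab
    refine (chainDist_step g x ha hab).trans (add_le_add_right ?_ _)
    rw [ENNReal.ofReal_mul (by positivity), ← edist_dist, edist_comm]
    gcongr
    exact min_le_left _ _
  have h := ofReal_abs_sub_toReal_min_le (key a ha b hb hab)
    (by have := key b hb a ha (by rwa [dist_comm]); rwa [dist_comm b a] at this)
  exact (ENNReal.ofReal_le_ofReal_iff (by positivity)).1 h

theorem continuousOn_chainPotential (K : Set Y) (g : Y → ℝ≥0∞) {δ : ℝ} (hδ : 0 < δ) (x : Y) :
    ContinuousOn (chainPotential K g δ x) K := by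
  refine Metric.continuousOn_iff.2 fun b hb ε hε => ⟨min δ (δ * ε), by positivity, ?_⟩
  intro a ha hab
  rw [Real.dist_eq]
  refine (chainPotential_sub_le g hδ x ha hb (hab.trans_le (min_le_left _ _))).trans_lt ?_
  rw [inv_mul_lt_iff₀ hδ]
  exact hab.trans_le (min_le_right _ _)

/-- No chain ends off `K`, so the potential is the constant `1` there, glued to a continuous
function on a closed set. -/
theorem measurable_chainPotential [MeasurableSpace Y] [BorelSpace Y] {K : Set Y} (hK : IsClosed K)
    (g : Y → ℝ≥0∞) {δ : ℝ} (hδ : 0 < δ) (x : Y) : Measurable (chainPotential K g δ x) := by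
  classical
  have h : chainPotential K g δ x = K.piecewise (chainPotential K g δ x) (fun _ => 1) := by
    ext y
    by_cases hy : y ∈ K
    · simp [hy]
    · simp [hy, chainPotential, chainDist_of_notMem]
  rw [h]
  exact (continuousOn_chainPotential K g hδ x).measurable_piecewise continuousOn_const
    hK.measurableSet

/-- If `g` is infinite off the closed set `K`, then the upper gradient inequality for real
functions only has to be checked along the curves in `K`. -/
theorem isUpperGradient_of_curves_in [MeasurableSpace Y] {K : Set Y} (hK : IsClosed K)
    {g : Y → ℝ≥0∞} (hg : Measurable g) (hgK : ∀ y ∉ K, g y = ⊤) {u : Y → ℝ}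
    (hu : ∀ γ : Curve Y, γ.Rectifiable → γ.Nonconstant → (∀ t, γ t ∈ K) →
      ENNReal.ofReal |u (γ 0) - u (γ 1)| ≤ γ.pathIntegral g) :
    IsUpperGradient (fun y => (u y : EReal)) g := by
  refine ⟨hg, fun γ hγ hn => ⟨fun a b ha hb => ?_, fun h => by simp at h⟩⟩
  rw [EReal.coe_eq_coe_iff] at ha hb
  rw [← ha, ← hb]
  by_cases h : ∀ t, γ t ∈ K
  · exact hu γ hγ hn h
  · push Not at h
    rw [Curve.pathIntegral_eq_top hγ hn hK hgK h]
    exact le_top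

theorem isUpperGradient_chainPotential [MeasurableSpace Y] {K : Set Y} (hK : IsClosed K)
    {g : Y → ℝ≥0∞} (hg : Measurable g) (hgK : ∀ y ∉ K, g y = ⊤) {δ : ℝ} (hδ : 0 < δ) (x : Y) :
    IsUpperGradient (fun y => (chainPotential K g δ x y : EReal)) g := by
  refine isUpperGradient_of_curves_in hK hg hgK fun γ hγ _ hin => ?_
  have h := le_add_lintegral_of_step (K := K) (g := g) hδ (w := chainDist K g δ x)
    (fun a _ b hb hab => chainDist_step g x hb hab) ENNReal.toReal_nonneg hγ.nat_lipschitzOn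
    (fun s hs => hγ.nat_mem hin hs)
  rw [Curve.nat_zero hγ, Curve.nat_length hγ] at h
  exact ofReal_abs_sub_toReal_min_le h.2 h.1

end Chains

/-! ### From chains to curves. -/

section Compactness

variable {Y : Type*} [MetricSpace Y]

/-- Supplies the measurability needed for monotone convergence along the limit curve. -/
theorem upperSemicontinuous_infCost (g : Y → ℝ≥0∞) (δ : ℝ) :
    UpperSemicontinuous (infCost g δ) := by
  intro a c hc
  rcases min_lt_iff.1 hc with h | h
  · exact Eventually.of_forall fun b => (min_le_left _ _).trans_lt h
  · simp only [iInf_lt_iff] at h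
    obtain ⟨z, hz, hzc⟩ := h
    rw [mem_ball'] at hz
    filter_upwards [isOpen_ball.mem_nhds (mem_ball.2 hz)] with b hb
    rw [mem_ball'] at hb
    exact (infCost_le g hb).trans_lt hzc

/-- The cap tends to infinity, and infima over shrinking balls recover `g` by lower semicontinuity.
-/
theorem iSup_infCost {g : Y → ℝ≥0∞} (hg : LowerSemicontinuous g) (z : Y) :
    ⨆ m : ℕ, infCost g (1 / ((m : ℝ) + 1)) z = g z := by
  refine le_antisymm (iSup_le fun m => infCost_le g (by simp; positivity)) ?_
  refine le_of_forall_lt fun c hc => ?_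
  obtain ⟨c', hcc', hc'⟩ := exists_between hc
  obtain ⟨r, hr, hball⟩ := Metric.mem_nhds_iff.1 (hg z c' hc')
  have hc'top : c' ≠ ⊤ := (hc'.trans_le le_top).ne
  obtain ⟨m, hm⟩ := exists_nat_gt (max r⁻¹ c'.toReal)
  rw [max_lt_iff] at hm
  have hm1 : (0 : ℝ) < m + 1 := by positivity
  refine hcc'.trans_le (le_iSup_of_le m (le_min ?_ ?_))
  · rw [one_div, inv_inv]
    exact (ENNReal.le_ofReal_iff_toReal_le hc'top hm1.le).2 (by linarith)
  · refine le_iInf₂ fun w hw => ?_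
    have : w ∈ ball z r := by
      rw [mem_ball] at hw ⊢
      refine hw.trans ?_
      rw [one_div, inv_lt_comm₀ hm1 hr]
      linarith
    exact (hball this).le

/-- A chain of positive length is traversed by a step path at approximately constant speed. -/
theorem IsDeltaChain.exists_stepPath {K : Set Y} {δ : ℝ} {x y : Y} {c : ℕ → Y} {n : ℕ}
    (h : IsDeltaChain K δ x y c n) {ℓ : ℝ}
    (hℓ : ℓ = ∑ i ∈ Finset.range n, dist (c i) (c (i + 1))) (hpos : 0 < ℓ) (hδ : 0 < δ) :
    ∃ φ : ℝ → Y, (∀ t, φ t ∈ K) ∧ φ 0 = x ∧ φ 1 = y ∧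
      (∀ s t, s ≤ t → t ≤ 1 → 0 ≤ s → dist (φ s) (φ t) ≤ ℓ * (t - s) + δ) ∧
      ∀ f : Y → ℝ≥0∞, ENNReal.ofReal ℓ * ∫⁻ t in Ico (0 : ℝ) 1, f (φ t) ≤
        ∑ i ∈ Finset.range n, f (c i) * edist (c i) (c (i + 1)) := by
  classical
  -- Time is accumulated length, normalised to total `1`. Between times `S i` and `S (i + 1)` the
  -- path waits at `c i`.
  set S : ℕ → ℝ := fun k => (∑ i ∈ Finset.range k, dist (c i) (c (i + 1))) / ℓ with hS
  have hS0 : S 0 = 0 := by simp [hS]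
  have hS1 : S n = 1 := by simp only [hS, ← hℓ]; exact div_self hpos.ne'
  have hSs : ∀ k, ℓ * (S (k + 1) - S k) = dist (c k) (c (k + 1)) := by
    intro k
    simp only [hS, Finset.sum_range_succ]
    field_simp
    ring
  have hSm : Monotone S := monotone_nat_of_le_succ fun k => by
    have h1 := hSs k
    have h2 : 0 ≤ ℓ * (S (k + 1) - S k) := h1 ▸ dist_nonneg
    have := nonneg_of_mul_nonneg_right h2 hpos
    linarith
  have hdist : ∀ i j, i ≤ j → dist (c i) (c j) ≤ ℓ * (S j - S i) := by
    intro i j hij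
    induction j, hij using Nat.le_induction with
    | base => simp
    | succ j _ ih => linarith [hSs j, dist_triangle (c i) (c j) (c (j + 1))]
  set ι : ℝ → ℕ := fun t => Nat.findGreatest (fun k => S k ≤ t) n with hι
  have hιn : ∀ t, ι t ≤ n := fun t => Nat.findGreatest_le n
  have hιS : ∀ t, 0 ≤ t → S (ι t) ≤ t := fun t ht =>
    Nat.findGreatest_spec (P := fun k => S k ≤ t) (Nat.zero_le n) (by rw [hS0]; exact ht)
  have hιg : ∀ t, ι t < n → t < S (ι t + 1) := fun t ht =>
    not_le.1 (Nat.findGreatest_is_greatest (P := fun k => S k ≤ t) (Nat.lt_succ_self _) ht)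
  refine ⟨fun t => c (ι t), fun t => h.mem _ (hιn t), ?_, ?_, ?_, ?_⟩
  -- `ι 0` is positive if the chain begins with steps of length zero, but these do not move the
  -- point.
  · have h1 := hdist 0 (ι 0) (Nat.zero_le _)
    have h2 := hιS 0 le_rfl
    rw [hS0] at h1
    have h3 : dist (c 0) (c (ι 0)) ≤ 0 := h1.trans (by nlinarith)
    rw [← h.start]
    exact (dist_le_zero.1 h3).symm
  · have : ι 1 = n := Nat.findGreatest_eq (P := fun k => S k ≤ 1) hS1.le
    simp only [this, h.finish]
  · intro s t hst ht1 hs0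
    have hij : ι s ≤ ι t := Nat.findGreatest_mono (fun k hk => le_trans hk hst) le_rfl
    rcases (hιn s).lt_or_eq with hlt | heq
    -- At time `s` part of the current step may already have elapsed, hence the extra `δ`.
    · refine (hdist _ _ hij).trans ?_
      have h1 := hιS t (hs0.trans hst)
      have h2 := (hιg s hlt).le
      have h3 := h.step _ hlt
      rw [← hSs] at h3
      have h4 : ℓ * S (ι t) ≤ ℓ * t := by gcongr
      have h5 : ℓ * s ≤ ℓ * S (ι s + 1) := by gcongr
      linarith
    · have : ι t = ι s := le_antisymm (heq ▸ hιn t) hij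
      simp only [this, dist_self]
      have : 0 ≤ ℓ * (t - s) := mul_nonneg hpos.le (sub_nonneg.2 hst)
      linarith
  · intro f
    have main : ∀ k ≤ n, ENNReal.ofReal ℓ * ∫⁻ t in Ico (0 : ℝ) (S k), f (c (ι t)) ≤
        ∑ i ∈ Finset.range k, f (c i) * edist (c i) (c (i + 1)) := by
      intro k
      induction k with
      | zero => intro _; simp [hS0]
      | succ k ih =>
        intro hk
        have hk0 : 0 ≤ S k := hS0 ▸ hSm (Nat.zero_le k)
        rw [Finset.sum_range_succ, ← Ico_union_Ico_eq_Ico hk0 (hSm k.le_succ),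
          lintegral_union measurableSet_Ico (Ico_disjoint_Ico_same), mul_add]
        refine add_le_add (ih (by omega)) (le_of_eq ?_)
        have hcon : ∫⁻ t in Ico (S k) (S (k + 1)), f (c (ι t)) =
            ∫⁻ _ in Ico (S k) (S (k + 1)), f (c k) := by
          refine setLIntegral_congr_fun measurableSet_Ico fun t ht => ?_
          have : ι t = k := by
            refine (Nat.findGreatest_eq_iff).2 ⟨by omega, fun _ => ht.1, fun m hm _ hc => ?_⟩
            exact absurd (ht.2.trans_le (hSm hm)) (not_lt.2 hc)
          simp only [this]
        rw [hcon, setLIntegral_const, Real.volume_Ico, edist_dist, ← hSs,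
          ENNReal.ofReal_mul hpos.le]
        ring
    have := main n le_rfl
    rwa [hS1] at this

/-- If `K` is compact and `g` is lower semicontinuous, then the chain distances from `x` to `y` in
`K` control the path integral of `g` along some curve in `K` from `x` to `y`. -/
theorem exists_curve_of_chainDist_lt {K : Set Y} (hK : IsCompact K) {g : Y → ℝ≥0∞}
    (hg : LowerSemicontinuous g) {ε : ℝ} (hε : 0 < ε) (hε1 : ε ≤ 1)
    (hgε : ∀ y, ENNReal.ofReal ε ≤ g y) {x y : Y} (hxy : x ≠ y) {L : ℝ≥0∞} (hL : L ≠ ⊤)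
    (h : ∀ n : ℕ, chainDist K g (1 / ((n : ℝ) + 1)) x y < L) :
    ∃ γ : Curve Y, γ.Rectifiable ∧ (∀ t, γ t ∈ K) ∧ γ 0 = x ∧ γ 1 = y ∧
      γ.pathIntegral g ≤ L := by
  set δ : ℕ → ℝ := fun n => 1 / ((n : ℝ) + 1) with hδ
  have hδ0 : ∀ n, 0 < δ n := fun n => by simp only [hδ]; positivity
  choose c N hc hcost using fun n => exists_chain_of_chainDist_lt (h n)
  set ℓ : ℕ → ℝ := fun n => ∑ i ∈ Finset.range (N n), dist (c n i) (c n (i + 1)) with hℓ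
  have hℓpos : ∀ n, 0 < ℓ n := fun n => by
    refine lt_of_lt_of_le (dist_pos.2 hxy) ?_
    have := dist_le_range_sum_dist (c n) (N n)
    rwa [(hc n).start, (hc n).finish] at this
  -- The lower bound `ε` turns the bound on costs into a bound on chain lengths. Since `ε ≤ 1`, the
  -- caps `n + 1` do not spoil it.
  set Λ : ℝ := L.toReal / ε with hΛ
  have hcostε : ∀ n a, ENNReal.ofReal ε ≤ infCost g (δ n) a := by
    intro n a
    refine le_min (ENNReal.ofReal_le_ofReal ?_) (le_iInf₂ fun z _ => hgε z)
    simp only [hδ, one_div, inv_inv]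
    have : (0 : ℝ) ≤ n := Nat.cast_nonneg n
    linarith
  have hℓΛ : ∀ n, ℓ n ≤ Λ := by
    intro n
    have h1 : ENNReal.ofReal (ε * ℓ n) ≤ L := by
      refine le_trans ?_ (hcost n).le
      rw [ENNReal.ofReal_mul hε.le, hℓ, ENNReal.ofReal_sum_of_nonneg fun _ _ => dist_nonneg,
        Finset.mul_sum]
      refine Finset.sum_le_sum fun i _ => ?_
      rw [← edist_dist]
      gcongr
      exact hcostε n _
    rw [hΛ, le_div_iff₀ hε, mul_comm]
    exact (ENNReal.ofReal_le_iff_le_toReal hL).1 h1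
  choose φ hφK hφ0 hφ1 hφd hφi using fun n =>
    (hc n).exists_stepPath (ℓ := ℓ n) rfl (hℓpos n) (hδ0 n)
  -- In a compact set, limits along an ultrafilter exist at all times simultaneously, with no
  -- extraction of subsequences.
  set 𝒰 : Ultrafilter ℕ := hyperfilter ℕ with h𝒰
  have h𝒰top : (𝒰 : Filter ℕ) ≤ atTop := Nat.hyperfilter_le_atTop
  have hδlim : Tendsto δ 𝒰 (𝓝 0) := tendsto_one_div_add_atTop_nhds_zero_nat.mono_left h𝒰top
  have hlim : ∀ t, ∃ z ∈ K, Tendsto (fun n => φ n t) 𝒰 (𝓝 z) := fun t =>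
    hK.ultrafilter_le_nhds (𝒰.map fun n => φ n t)
      (le_principal_iff.2 (Ultrafilter.mem_map.2 (Eventually.of_forall fun n => hφK n t)))
  choose γ hγK hγ using hlim
  obtain ⟨l, hl, hlt⟩ : ∃ l ∈ Icc 0 Λ, Tendsto ℓ 𝒰 (𝓝 l) :=
    isCompact_Icc.ultrafilter_le_nhds (𝒰.map ℓ)
      (le_principal_iff.2 (Ultrafilter.mem_map.2
        (Eventually.of_forall fun n => ⟨(hℓpos n).le, hℓΛ n⟩)))
  lift l to ℝ≥0 using hl.1
  have hγd' : ∀ s t, s ≤ t → t ≤ 1 → 0 ≤ s → dist (γ s) (γ t) ≤ l * (t - s) := by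
    intro s t hst ht hs
    have h1 := ((hlt.mul_const (t - s)).add hδlim)
    rw [add_zero] at h1
    exact le_of_tendsto_of_tendsto ((hγ s).dist (hγ t)) h1
      (Eventually.of_forall fun n => hφd n s t hst ht hs)
  have hγd : ∀ s ∈ Icc (0 : ℝ) 1, ∀ t ∈ Icc (0 : ℝ) 1, dist (γ s) (γ t) ≤ l * |s - t| := by
    intro s hs t ht
    rcases le_total s t with hst | hst
    · rw [abs_sub_comm, abs_of_nonneg (sub_nonneg.2 hst)]
      exact hγd' s t hst ht.2 hs.1
    · rw [dist_comm, abs_of_nonneg (sub_nonneg.2 hst)]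
      exact hγd' t s hst hs.2 ht.1
  have hφdd : ∀ n, ∀ s ∈ Icc (0 : ℝ) 1, ∀ t ∈ Icc (0 : ℝ) 1,
      dist (φ n s) (φ n t) ≤ ℓ n * |s - t| + δ n := by
    intro n s hs t ht
    rcases le_total s t with hst | hst
    · rw [abs_sub_comm, abs_of_nonneg (sub_nonneg.2 hst)]
      exact hφd n s t hst ht.2 hs.1
    · rw [dist_comm, abs_of_nonneg (sub_nonneg.2 hst)]
      exact hφd n t s hst hs.2 ht.1
  -- the step paths converge uniformly along the ultrafilter
  have hunif : ∀ η > 0, ∀ᶠ n in (𝒰 : Filter ℕ), ∀ t ∈ Icc (0 : ℝ) 1,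
      δ n + dist (φ n t) (γ t) ≤ η := by
    intro η hη
    -- Closeness is imposed on the finite grid `j / M`; the common speed bound `Λ` handles the times
    -- in between.
    obtain ⟨M, hM⟩ := exists_nat_gt (Λ / (η / 8))
    have hΛ0 : 0 ≤ Λ := by positivity
    have hM0 : (0 : ℝ) < M := lt_of_le_of_lt (by positivity) hM
    have hΛM : Λ * (1 / M) < η / 8 := by
      rw [div_lt_iff₀ (by positivity)] at hM
      rw [mul_one_div, div_lt_iff₀ hM0]
      linarith
    have hgrid : ∀ᶠ n in (𝒰 : Filter ℕ), ∀ j ∈ Finset.range (M + 1),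
        dist (φ n (j / M)) (γ (j / M)) < η / 4 := by
      rw [Filter.eventually_all_finset]
      intro j _
      exact (tendsto_iff_dist_tendsto_zero.1 (hγ (j / M))).eventually_lt_const (by positivity)
    filter_upwards [hgrid, hδlim.eventually_lt_const (show (0 : ℝ) < η / 8 by positivity)]
      with n hn hδn t ht
    set j := ⌊t * M⌋₊ with hj
    have htM : 0 ≤ t * M := mul_nonneg ht.1 hM0.le
    have hj1 : (j : ℝ) ≤ t * M := Nat.floor_le htM
    have hj2 : t * M < j + 1 := Nat.lt_floor_add_one _
    have hjM : (j : ℝ) ≤ M := hj1.trans (by nlinarith [ht.2])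
    have hjI : (j : ℝ) / M ∈ Icc (0 : ℝ) 1 := ⟨by positivity, (div_le_one hM0).2 hjM⟩
    have habs : |t - j / M| ≤ 1 / M := by
      rw [abs_le]
      have e : t = t * M / M := by field_simp
      constructor
      · have : (j : ℝ) / M ≤ t := by rw [div_le_iff₀ hM0]; exact hj1
        have : (0 : ℝ) ≤ 1 / M := by positivity
        linarith
      · rw [e, ← sub_div]
        gcongr
        linarith
    have h1 := hφdd n t ht _ hjI
    have h2 := hγd _ hjI t ht
    rw [abs_sub_comm] at h2
    have h3 := hn j (Finset.mem_range.2 (by have : j ≤ M := by exact_mod_cast hjM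
                                            omega))
    have h4 : ℓ n * |t - j / M| ≤ Λ * (1 / M) :=
      mul_le_mul (hℓΛ n) habs (abs_nonneg _) hΛ0
    have h5 : l * |t - j / M| ≤ Λ * (1 / M) := mul_le_mul hl.2 habs (abs_nonneg _) hΛ0
    have h6 := dist_triangle4 (φ n t) (φ n (j / M)) (γ (j / M)) (γ t)
    linarith
  set Γ : Curve Y := ⟨fun t => γ t, (LipschitzWith.of_dist_le_mul (K := l) fun s t => by
    simpa [Subtype.dist_eq, Real.dist_eq] using hγd s s.2 t t.2).continuous⟩ with hΓ
  obtain ⟨hrect, hint⟩ := Curve.pathIntegral_le_lipschitz (γ := Γ) l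
    (fun s t => hγd s s.2 t t.2)
  refine ⟨Γ, hrect, fun t => hγK t, ?_, ?_, (hint g).trans ?_⟩
  · refine tendsto_nhds_unique (hγ 0) ?_
    simp only [hφ0]; exact tendsto_const_nhds
  · refine tendsto_nhds_unique (hγ 1) ?_
    simp only [hφ1]; exact tendsto_const_nhds
  set ψ : ℝ → Y := fun t => Γ (projIcc 0 1 zero_le_one t) with hψ
  have hψc : Continuous ψ := Γ.continuous.comp continuous_projIcc
  have hψγ : ∀ t ∈ Icc (0 : ℝ) 1, ψ t = γ t := fun t ht => by
    simp [hψ, hΓ, projIcc_of_mem _ ht]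
  rw [← ENNReal.ofReal_coe_nnreal (p := l)]
  -- With the scale `δ m` frozen, the cost on the limit curve is below that of the `n`-th chain for
  -- `𝒰`-most `n`. Afterwards `m → ∞` by monotone convergence.
  have hstage : ∀ m : ℕ, ENNReal.ofReal l * ∫⁻ t in Icc (0 : ℝ) 1, infCost g (δ m) (ψ t) ≤ L := by
    intro m
    have hA : ∫⁻ t in Icc (0 : ℝ) 1, infCost g (δ m) (ψ t) ≠ ⊤ := by
      have h1 : ∫⁻ t in Icc (0 : ℝ) 1, infCost g (δ m) (ψ t) ≤
          ∫⁻ _ in Icc (0 : ℝ) 1, ENNReal.ofReal (δ m)⁻¹ := lintegral_mono fun t => min_le_left _ _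
      exact (h1.trans_lt (by simp)).ne
    have hlim2 : Tendsto (fun n => ENNReal.ofReal (ℓ n) *
        ∫⁻ t in Icc (0 : ℝ) 1, infCost g (δ m) (ψ t)) 𝒰
        (𝓝 (ENNReal.ofReal l * ∫⁻ t in Icc (0 : ℝ) 1, infCost g (δ m) (ψ t))) :=
      ENNReal.Tendsto.mul_const ((ENNReal.continuous_ofReal.tendsto l).comp hlt) (Or.inr hA)
    refine le_of_tendsto hlim2 ?_
    filter_upwards [hunif (δ m) (hδ0 m)] with n hn
    refine le_trans ?_ ((hφi n (infCost g (δ n))).trans (hcost n).le)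
    rw [setLIntegral_congr Ico_ae_eq_Icc]
    refine mul_le_mul_right (setLIntegral_mono' measurableSet_Icc fun t ht => ?_) _
    rw [hψγ t ht]
    exact infCost_anti g (hδ0 n) (hn t ht)
  have hsup : ∀ t, g (ψ t) = ⨆ m : ℕ, infCost g (δ m) (ψ t) := fun t => (iSup_infCost hg _).symm
  change ENNReal.ofReal l * ∫⁻ t in Icc (0 : ℝ) 1, g (ψ t) ≤ L
  rw [lintegral_congr hsup, lintegral_iSup (f := fun m t => infCost g (δ m) (ψ t))
    (fun m => ((upperSemicontinuous_infCost g (δ m)).comp hψc).measurable),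
    ENNReal.mul_iSup]
  · exact iSup_le hstage
  · intro m m' hmm t
    refine infCost_anti g (hδ0 m') ?_
    simp only [dist_self, add_zero, hδ]
    gcongr

end Compactness

/-! ### Balls under a doubling measure. -/

section Doubling

variable {Y : Type*} [MetricSpace Y] [MeasurableSpace Y] {μ : Measure Y} {Cμ : ℝ}

theorem IsDoublingMeasure.ball_pos (hμ : IsDoublingMeasure μ Cμ) (x : Y) {r : ℝ} (hr : 0 < r) :
    0 < μ (ball x r) := by
  have := (hμ x (r / 2) (by positivity)).1
  rwa [mul_div_cancel₀ _ two_ne_zero] at this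

theorem IsDoublingMeasure.ball_lt_top (hμ : IsDoublingMeasure μ Cμ) (x : Y) (r : ℝ) :
    μ (ball x r) < ⊤ := by
  rcases le_or_gt r 0 with hr | hr
  · simp [ball_eq_empty.2 hr]
  · have h := hμ x (r / 2) (by positivity)
    rw [mul_div_cancel₀ _ two_ne_zero] at h
    exact h.2.1.trans_lt h.2.2

theorem IsDoublingMeasure.ball_two_pow_le (hμ : IsDoublingMeasure μ Cμ) (x : Y) {r : ℝ}
    (hr : 0 < r) (k : ℕ) : μ (ball x (2 ^ k * r)) ≤ ENNReal.ofReal Cμ ^ k * μ (ball x r) := by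
  induction k with
  | zero => simp
  | succ k ih =>
    rw [pow_succ', mul_assoc, pow_succ', mul_assoc]
    exact (hμ x _ (by positivity)).2.1.trans (by gcongr)

end Doubling

/-! ### Comparison of averages. -/

section Averages

variable {Y : Type*} [MeasurableSpace Y] {μ : Measure Y}

theorem laverage_le_of_subset {A B : Set Y} (hAB : A ⊆ B) (hA : μ A ≠ 0) (hB : μ B ≠ ⊤) {D : ℝ≥0∞}
    (hD : μ B ≤ D * μ A) (f : Y → ℝ≥0∞) :
    ⨍⁻ y in A, f y ∂μ ≤ D * ⨍⁻ y in B, f y ∂μ := by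
  rw [setLAverage_eq, setLAverage_eq, ENNReal.div_eq_inv_mul, ENNReal.div_eq_inv_mul, ← mul_assoc]
  have hB0 : μ B ≠ 0 := fun h => hA (measure_mono_null hAB h)
  have hA' : μ A ≠ ⊤ := ((measure_mono hAB).trans_lt hB.lt_top).ne
  refine mul_le_mul' ?_ (lintegral_mono_set hAB)
  calc (μ A)⁻¹ = (μ A)⁻¹ * (μ B * (μ B)⁻¹) := by rw [ENNReal.mul_inv_cancel hB0 hB, mul_one]
    _ ≤ (μ A)⁻¹ * (D * μ A * (μ B)⁻¹) := by gcongr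
    _ = (μ A)⁻¹ * μ A * (D * (μ B)⁻¹) := by ring
    _ = D * (μ B)⁻¹ := by rw [ENNReal.inv_mul_cancel hA hA', one_mul]

theorem setLAverage_le_const {A : Set Y} (hA : MeasurableSet A) {f : Y → ℝ≥0∞} {c : ℝ≥0∞}
    (h : ∀ y ∈ A, f y ≤ c) : ⨍⁻ y in A, f y ∂μ ≤ c := by
  rw [setLAverage_eq]
  refine ENNReal.div_le_of_le_mul ?_
  exact (setLIntegral_mono' hA h).trans (by simp)

theorem ofReal_abs_average_sub_le {A : Set Y} (hA : μ A ≠ 0) (hA' : μ A ≠ ⊤) {u : Y → ℝ}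
    (hu : IntegrableOn u A μ) (c : ℝ) :
    ENNReal.ofReal |⨍ y in A, u y ∂μ - c| ≤ ⨍⁻ y in A, ENNReal.ofReal |u y - c| ∂μ := by
  have h1 : ⨍ y in A, u y ∂μ - c = ⨍ y in A, (u y - c) ∂μ := by
    rw [setAverage_eq, setAverage_eq, integral_sub hu (integrableOn_const hA')]
    simp only [integral_const, smul_eq_mul, measureReal_restrict_apply_univ, mul_sub]
    rw [inv_mul_cancel_left₀]
    rw [measureReal_def]
    exact (ENNReal.toReal_pos hA hA').ne'
  rw [h1, setAverage_eq, setLAverage_eq, smul_eq_mul, abs_mul, ENNReal.ofReal_mul (abs_nonneg _),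
    ENNReal.div_eq_inv_mul]
  refine mul_le_mul' (le_of_eq ?_) ?_
  · rw [abs_of_nonneg (by positivity), measureReal_def, ← ENNReal.toReal_inv,
      ENNReal.ofReal_toReal (ENNReal.inv_ne_top.2 hA)]
  · have := enorm_integral_le_lintegral_enorm (μ := μ.restrict A) (fun y => u y - c)
    simpa only [Real.enorm_eq_ofReal_abs] using this

theorem integrableOn_of_bounded {A : Set Y} (hA : μ A ≠ ⊤) {u : Y → ℝ} (hu : AEMeasurable u μ)
    (h0 : ∀ y, 0 ≤ u y) (h1 : ∀ y, u y ≤ 1) : IntegrableOn u A μ :=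
  Measure.integrableOn_of_bounded hA hu.aestronglyMeasurable (M := 1)
    (Eventually.of_forall fun y => by rw [Real.norm_eq_abs, abs_of_nonneg (h0 y)]; exact h1 y)

end Averages

/-! ### Telescoping the Poincaré inequality. -/

section Telescoping

variable {Y : Type*} [MetricSpace Y] [MeasurableSpace Y] {μ : Measure Y} {p Cμ CP lam : ℝ}

/-- The dyadic potential of `g` at `x`, up to the scale `r`. -/
def dyadicPotential (μ : Measure Y) (p lam : ℝ) (g : Y → ℝ≥0∞) (x : Y) (r : ℝ) : ℝ≥0∞ :=
  ∑' k : ℕ, ENNReal.ofReal (r / 2 ^ k) *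
    (⨍⁻ y in ball x (lam * (r / 2 ^ k)), g y ^ p ∂μ) ^ (1 / p)

theorem poincare_subset (hμ : IsDoublingMeasure μ Cμ) (hP : SupportsPoincare μ p CP lam)
    (hCP : 0 < CP) {u : Y → ℝ} {g : Y → ℝ≥0∞} (hu : AEMeasurable u μ) (h0 : ∀ y, 0 ≤ u y)
    (h1 : ∀ y, u y ≤ 1) (hg : IsUpperGradient (fun y => (u y : EReal)) g) {x : Y} {r : ℝ}
    (hr : 0 < r) {A : Set Y} (hA : A ⊆ ball x r) (hA0 : μ A ≠ 0) {D : ℝ≥0∞}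
    (hD : μ (ball x r) ≤ D * μ A) :
    ENNReal.ofReal |⨍ y in A, u y ∂μ - ⨍ y in ball x r, u y ∂μ| ≤
      D * (ENNReal.ofReal CP * (ENNReal.ofReal r *
        (⨍⁻ y in ball x (lam * r), g y ^ p ∂μ) ^ (1 / p))) := by
  have hB := (hμ.ball_lt_top x r).ne
  have hA' : μ A ≠ ⊤ := ((measure_mono hA).trans_lt hB.lt_top).ne
  refine (ofReal_abs_average_sub_le hA0 hA' (integrableOn_of_bounded hA' hu h0 h1) _).trans ?_
  refine (laverage_le_of_subset hA hA0 hB hD _).trans ?_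
  rw [← mul_assoc (ENNReal.ofReal CP), ← ENNReal.ofReal_mul hCP.le]
  exact mul_le_mul_right (hP u g hu hg x r hr) _

/-- Each halving of the radius costs one Poincaré inequality and one doubling constant. -/
theorem telescoping (hμ : IsDoublingMeasure μ Cμ) (hP : SupportsPoincare μ p CP lam)
    (hCP : 0 < CP) {u : Y → ℝ} {g : Y → ℝ≥0∞} (hu : AEMeasurable u μ) (h0 : ∀ y, 0 ≤ u y)
    (h1 : ∀ y, u y ≤ 1) (hg : IsUpperGradient (fun y => (u y : EReal)) g) (x : Y) {r : ℝ}
    (hr : 0 < r) (k : ℕ) :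
    ENNReal.ofReal |⨍ y in ball x (r / 2 ^ k), u y ∂μ - ⨍ y in ball x r, u y ∂μ| ≤
      ENNReal.ofReal Cμ * ENNReal.ofReal CP * ∑ i ∈ Finset.range k, ENNReal.ofReal (r / 2 ^ i) *
        (⨍⁻ y in ball x (lam * (r / 2 ^ i)), g y ^ p ∂μ) ^ (1 / p) := by
  induction k with
  | zero => simp
  | succ k ih =>
    have hrk : 0 < r / 2 ^ k := by positivity
    have hrk' : 0 < r / 2 ^ (k + 1) := by positivity
    have h2 : r / 2 ^ k = 2 * (r / 2 ^ (k + 1)) := by rw [pow_succ]; field_simp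
    have hstep := poincare_subset hμ hP hCP hu h0 h1 hg hrk (A := ball x (r / 2 ^ (k + 1)))
      (ball_subset_ball (by linarith)) (hμ.ball_pos x hrk').ne' (D := ENNReal.ofReal Cμ)
      (by nth_rewrite 1 [h2]; exact (hμ x _ hrk').2.1)
    rw [← mul_assoc] at hstep
    rw [Finset.sum_range_succ, mul_add]
    refine le_trans ?_ (add_le_add ih hstep)
    rw [← ENNReal.ofReal_add (abs_nonneg _) (abs_nonneg _)]
    exact ENNReal.ofReal_le_ofReal ((abs_sub_le _ _ _).trans_eq (add_comm _ _))

theorem dyadicPotential_congr {g h : Y → ℝ≥0∞} {x : Y} {r : ℝ} (hlam : 0 ≤ lam) (hr : 0 ≤ r)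
    (hgh : ∀ y ∈ ball x (lam * r), g y = h y) [OpensMeasurableSpace Y] :
    dyadicPotential μ p lam g x r = dyadicPotential μ p lam h x r := by
  refine tsum_congr fun k => ?_
  congr 2
  refine laverage_congr ?_
  refine (ae_restrict_iff' measurableSet_ball).2 (Eventually.of_forall fun y hy => ?_)
  dsimp only
  rw [hgh y (ball_subset_ball ?_ hy)]
  exact mul_le_mul_of_nonneg_left (div_le_self hr (one_le_pow₀ one_le_two)) hlam

/-- Lets a fine-scale and a coarse-scale estimate be added without loss of constants. -/
theorem sum_add_dyadicPotential (g : Y → ℝ≥0∞) (x : Y) (r : ℝ) (j : ℕ) :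
    (∑ i ∈ Finset.range j, ENNReal.ofReal (r / 2 ^ i) *
        (⨍⁻ y in ball x (lam * (r / 2 ^ i)), g y ^ p ∂μ) ^ (1 / p)) +
      dyadicPotential μ p lam g x (r / 2 ^ j) = dyadicPotential μ p lam g x r := by
  set f : ℕ → ℝ≥0∞ := fun i => ENNReal.ofReal (r / 2 ^ i) *
        (⨍⁻ y in ball x (lam * (r / 2 ^ i)), g y ^ p ∂μ) ^ (1 / p) with hf
  have h : dyadicPotential μ p lam g x (r / 2 ^ j) = ∑' k, f (k + j) := by
    refine tsum_congr fun k => ?_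
    simp only [hf, div_div, ← pow_add, add_comm j k]
  rw [h]
  exact Summable.sum_add_tsum_nat_add' (f := f) (k := j) ENNReal.summable

end Telescoping

/-! ### Extending local upper gradients by infinity. -/

section TopOff

variable {Y : Type*}

open Classical in
/-- The function equal to `g` on `K` and to `∞` elsewhere. -/
def topOff (K : Set Y) (g : Y → ℝ≥0∞) : Y → ℝ≥0∞ := fun y => if y ∈ K then g y else ⊤

theorem topOff_of_mem {K : Set Y} {g : Y → ℝ≥0∞} {y : Y} (hy : y ∈ K) : topOff K g y = g y :=
  if_pos hy

theorem topOff_of_notMem {K : Set Y} {g : Y → ℝ≥0∞} {y : Y} (hy : y ∉ K) : topOff K g y = ⊤ :=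
  if_neg hy

theorem le_topOff (K : Set Y) (g : Y → ℝ≥0∞) (y : Y) : g y ≤ topOff K g y := by
  rw [topOff]; split_ifs
  · exact le_rfl
  · exact le_top

theorem lowerSemicontinuous_topOff [TopologicalSpace Y] {K : Set Y} (hK : IsClosed K) {g : Y → ℝ≥0∞}
    (hg : LowerSemicontinuous g) : LowerSemicontinuous (topOff K g) := by
  intro y c hc
  by_cases hy : y ∈ K
  · rw [topOff_of_mem hy] at hc
    filter_upwards [hg y c hc] with z hz using hz.trans_le (le_topOff K g z)
  · rw [topOff_of_notMem hy] at hc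
    filter_upwards [hK.isOpen_compl.mem_nhds hy] with z hz
    rwa [topOff_of_notMem hz]

end TopOff

/-! ### The oscillation estimate at every point. -/

section Lebesgue

variable {Y : Type*} [MetricSpace Y] [MeasurableSpace Y] [BorelSpace Y] {μ : Measure Y}
  {p Cμ CP lam : ℝ}

/-- The Poincaré inequality is for functions on all of `Y`, while `u` is controlled only inside an
open set. Curves leaving the closed set `K` get infinite integral. -/
theorem isUpperGradient_topOff {K : Set Y} (hK : IsClosed K) {g : Y → ℝ≥0∞}
    (hg : LowerSemicontinuous g) {u : Y → ℝ}
    (hu : ∀ γ : Curve Y, γ.Rectifiable → γ.Nonconstant → (∀ t, γ t ∈ K) →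
      ENNReal.ofReal |u (γ 0) - u (γ 1)| ≤ γ.pathIntegral g) :
    IsUpperGradient (fun y => (u y : EReal)) (topOff K g) :=
  isUpperGradient_of_curves_in hK (lowerSemicontinuous_topOff hK hg).measurable
    (fun _ hy => topOff_of_notMem hy) fun γ hγ hn hin => (hu γ hγ hn hin).trans
      (Curve.pathIntegral_mono hγ hin fun y _ => le_topOff K g y)

/-- The potential is `0` at `x` and at most `δ⁻¹ * ρ` on small balls of radius `ρ` about `x`. Its
means over shrinking balls thus tend to `0`, and the telescoping sum bounds the mean over the whole
ball, uniformly in `δ`. -/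
theorem laverage_chainPotential_le (hμ : IsDoublingMeasure μ Cμ) (hP : SupportsPoincare μ p CP lam)
    (hCP : 0 < CP) {K : Set Y} (hK : IsClosed K) {g : Y → ℝ≥0∞} (hg : Measurable g)
    (hgK : ∀ y ∉ K, g y = ⊤) {x : Y} {r : ℝ} (hr : 0 < r) (hrK : ball x r ⊆ K) {δ : ℝ}
    (hδ : 0 < δ) :
    ⨍⁻ y in ball x r, ENNReal.ofReal (chainPotential K g δ x y) ∂μ ≤
      ENNReal.ofReal Cμ * ENNReal.ofReal CP * dyadicPotential μ p lam g x r := by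
  set v := chainPotential K g δ x with hv
  have hvm : AEMeasurable v μ := (measurable_chainPotential hK g hδ x).aemeasurable
  have hv0 : ∀ y, 0 ≤ v y := chainPotential_nonneg K g δ x
  have hv1 : ∀ y, v y ≤ 1 := chainPotential_le_one K g δ x
  have hxK : x ∈ K := hrK (mem_ball_self hr)
  have hint : ∀ s, IntegrableOn v (ball x s) μ := fun s =>
    integrableOn_of_bounded (hμ.ball_lt_top x s).ne hvm hv0 hv1
  have havg : ∀ s, ENNReal.ofReal (⨍ y in ball x s, v y ∂μ) =
      ⨍⁻ y in ball x s, ENNReal.ofReal (v y) ∂μ := fun s =>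
    (ofReal_average (hint s) (Eventually.of_forall hv0)).trans (laverage_eq _ _).symm
  have htel := telescoping hμ hP hCP hvm hv0 hv1
    (isUpperGradient_chainPotential hK hg hgK hδ x) x hr
  have hlim : Tendsto (fun k : ℕ => r / 2 ^ k) atTop (𝓝 0) := by
    simpa [div_eq_mul_inv] using
      (tendsto_pow_atTop_nhds_zero_of_lt_one (r := (2 : ℝ)⁻¹) (by norm_num)
        (by norm_num)).const_mul r
  have hlim2 : Tendsto (fun k : ℕ => ENNReal.ofReal Cμ * ENNReal.ofReal CP *
      dyadicPotential μ p lam g x r + ENNReal.ofReal (δ⁻¹ * (r / 2 ^ k))) atTop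
      (𝓝 (ENNReal.ofReal Cμ * ENNReal.ofReal CP * dyadicPotential μ p lam g x r)) := by
    have := (ENNReal.continuous_ofReal.tendsto _).comp (hlim.const_mul δ⁻¹)
    rw [mul_zero, ENNReal.ofReal_zero] at this
    simpa using tendsto_const_nhds.add this
  refine ge_of_tendsto hlim2 ?_
  filter_upwards [hlim.eventually_lt_const hδ] with k hk
  have hrk : 0 < r / 2 ^ k := by positivity
  have hrr : r / 2 ^ k ≤ r := div_le_self hr.le (one_le_pow₀ one_le_two)
  have h1 : ENNReal.ofReal (⨍ y in ball x (r / 2 ^ k), v y ∂μ) ≤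
      ENNReal.ofReal (δ⁻¹ * (r / 2 ^ k)) := by
    rw [havg]
    refine setLAverage_le_const measurableSet_ball fun y hy => ENNReal.ofReal_le_ofReal ?_
    have hyK := hrK (ball_subset_ball hrr hy)
    rw [mem_ball] at hy
    have := chainPotential_sub_le g hδ x hyK hxK (hy.trans hk)
    rw [chainPotential_self g δ hxK, sub_zero, abs_of_nonneg (chainPotential_nonneg _ _ _ _ _)]
      at this
    exact this.trans (by gcongr)
  have h2 := (htel k).trans (mul_le_mul_right (ENNReal.sum_le_tsum _) _)
  rw [← havg]
  refine le_trans ?_ (add_le_add h2 h1)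
  have hnn : 0 ≤ ⨍ y in ball x (r / 2 ^ k), v y ∂μ := by
    rw [setAverage_eq]; exact smul_nonneg (by positivity) (integral_nonneg hv0)
  rw [← ENNReal.ofReal_add (abs_nonneg _) hnn]
  refine ENNReal.ofReal_le_ofReal ?_
  rw [abs_sub_comm]
  linarith [le_abs_self (⨍ y in ball x r, v y ∂μ - ⨍ y in ball x (r / 2 ^ k), v y ∂μ)]

/-- At every point `x`, the oscillation of `u` around `u x` is controlled by the dyadic potential of
a lower semicontinuous upper gradient. -/
theorem laverage_abs_sub_le (hμ : IsDoublingMeasure μ Cμ) (hP : SupportsPoincare μ p CP lam)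
    (hCP : 0 < CP) (hlam : 1 ≤ lam) {K : Set Y} (hK : IsCompact K) {g : Y → ℝ≥0∞}
    (hg : LowerSemicontinuous g) {ε : ℝ} (hε : 0 < ε) (hε1 : ε ≤ 1)
    (hgε : ∀ y, ENNReal.ofReal ε ≤ g y) {u : Y → ℝ} (h0 : ∀ y, 0 ≤ u y) (h1 : ∀ y, u y ≤ 1)
    (hu : ∀ γ : Curve Y, γ.Rectifiable → γ.Nonconstant → (∀ t, γ t ∈ K) →
      ENNReal.ofReal |u (γ 0) - u (γ 1)| ≤ γ.pathIntegral g)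
    {x : Y} {r : ℝ} (hr : 0 < r) (hrK : ball x (lam * r) ⊆ K) :
    ⨍⁻ y in ball x r, ENNReal.ofReal |u y - u x| ∂μ ≤
      ENNReal.ofReal Cμ * ENNReal.ofReal CP * dyadicPotential μ p lam g x r := by
  set G := topOff K g with hG
  have hGl : LowerSemicontinuous G := lowerSemicontinuous_topOff hK.isClosed hg
  have hrK' : ball x r ⊆ K := (ball_subset_ball (by nlinarith)).trans hrK
  set v : ℕ → Y → ℝ := fun n => chainPotential K G (1 / ((n : ℝ) + 1)) x with hv
  have hn0 : ∀ n : ℕ, (0 : ℝ) < 1 / ((n : ℝ) + 1) := fun n => by positivity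
  have hbound : ∀ n, ⨍⁻ y in ball x r, ENNReal.ofReal (v n y) ∂μ ≤
      ENNReal.ofReal Cμ * ENNReal.ofReal CP * dyadicPotential μ p lam g x r := by
    intro n
    have := laverage_chainPotential_le hμ hP hCP hK.isClosed hGl.measurable
      (fun _ hy => topOff_of_notMem hy) hr hrK' (hn0 n)
    rwa [dyadicPotential_congr (by linarith) hr.le
      (fun y hy => topOff_of_mem (g := g) (hrK hy))] at this
  -- If all potentials at `y` stay below some `L < |u y - u x| ≤ 1`, the truncation at `1` is
  -- inactive, so all chain distances are below `L`. The resulting limit curve violates the upper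
  -- gradient inequality.
  have hpt : ∀ y, ENNReal.ofReal |u y - u x| ≤ ⨆ n, ENNReal.ofReal (v n y) := by
    intro y
    by_contra! hlt
    obtain ⟨L, hL1, hL2⟩ := exists_between hlt
    have hD1 : ENNReal.ofReal |u y - u x| ≤ 1 := by
      rw [← ENNReal.ofReal_one]
      refine ENNReal.ofReal_le_ofReal (abs_le.2 ⟨?_, ?_⟩) <;>
        linarith [h0 x, h0 y, h1 x, h1 y]
    have hxy : x ≠ y := by
      rintro rfl
      simp at hlt
    obtain ⟨γ, hγ, hγK, hγ0, hγ1, hγL⟩ := exists_curve_of_chainDist_lt hK hGl hε hε1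
      (fun z => (hgε z).trans (le_topOff K g z)) hxy (hL2.trans_le le_top).ne (fun n => by
        have h3 : ENNReal.ofReal (v n y) < L :=
          (le_iSup (fun n => ENNReal.ofReal (v n y)) n).trans_lt hL1
        rw [hv, ofReal_chainPotential, min_lt_iff] at h3
        exact h3.resolve_left (not_lt.2 (hL2.le.trans hD1)))
    have h4 := hu γ hγ ⟨0, 1, by rwa [hγ0, hγ1]⟩ hγK
    rw [hγ0, hγ1, abs_sub_comm] at h4
    exact absurd (h4.trans ((Curve.pathIntegral_mono hγ hγK fun z _ => le_topOff K g z).trans hγL))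
      (not_le.2 hL2)
  have hmono : Monotone fun n y => ENNReal.ofReal (v n y) := by
    intro n m hnm y
    simp only [hv, ofReal_chainPotential]
    refine min_le_min le_rfl (chainDist_anti K G (hn0 m) ?_ x y)
    gcongr
  refine (laverage_mono_ae (Eventually.of_forall hpt)).trans ?_
  rw [laverage_eq', lintegral_iSup (fun n =>
    (measurable_chainPotential hK.isClosed G (hn0 n) x).ennreal_ofReal) hmono]
  exact iSup_le hbound

/-- At every point of an open set `U`, the difference of `u` and its mean value over a ball is
controlled by the dyadic potential of a lower semicontinuous upper gradient of `u` in `U`. -/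
theorem ofReal_abs_sub_average_le [LocallyCompactSpace Y] (hμ : IsDoublingMeasure μ Cμ)
    (hP : SupportsPoincare μ p CP lam) (hCP : 0 < CP) (hlam : 1 ≤ lam) {K U : Set Y}
    (hK : IsClosed K) (hU : IsOpen U) (hKU : K ⊆ U) {g : Y → ℝ≥0∞}
    (hg : LowerSemicontinuous g) {ε : ℝ} (hε : 0 < ε) (hε1 : ε ≤ 1)
    (hgε : ∀ y, ENNReal.ofReal ε ≤ g y) {u : Y → ℝ} (hum : AEMeasurable u μ)
    (h0 : ∀ y, 0 ≤ u y) (h1 : ∀ y, u y ≤ 1)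
    (hu : ∀ γ : Curve Y, γ.Rectifiable → γ.Nonconstant → (∀ t, γ t ∈ U) →
      ENNReal.ofReal |u (γ 0) - u (γ 1)| ≤ γ.pathIntegral g)
    {x : Y} {r : ℝ} (hr : 0 < r) (hrK : ball x (lam * r) ⊆ K) :
    ENNReal.ofReal |u x - ⨍ y in ball x r, u y ∂μ| ≤
      ENNReal.ofReal Cμ * ENNReal.ofReal CP * dyadicPotential μ p lam g x r := by
  have hxU : x ∈ U := hKU (hrK (mem_ball_self (by positivity)))
  -- Compactness is only local: the oscillation estimate is used at a small scale `r / 2 ^ j`, and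
  -- telescoping for `u` itself covers the scales up to `r`.
  obtain ⟨C, hC, hCU, hCc⟩ := local_compact_nhds (hU.mem_nhds hxU)
  obtain ⟨ρ, hρ, hρC⟩ := Metric.mem_nhds_iff.1 hC
  have hlim : Tendsto (fun k : ℕ => lam * (r / 2 ^ k)) atTop (𝓝 0) := by
    simpa [div_eq_mul_inv] using
      ((tendsto_pow_atTop_nhds_zero_of_lt_one (r := (2 : ℝ)⁻¹) (by norm_num)
        (by norm_num)).const_mul r).const_mul lam
  obtain ⟨j, hj⟩ := (hlim.eventually_lt_const hρ).exists
  have hrj : 0 < r / 2 ^ j := by positivity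
  have hloc := laverage_abs_sub_le hμ hP hCP hlam hCc hg hε hε1 hgε h0 h1
    (fun γ hγ hn hin => hu γ hγ hn fun t => hCU (hin t)) hrj
    ((ball_subset_ball hj.le).trans hρC)
  have hpj := (hμ.ball_pos x hrj).ne'
  have hfin := (hμ.ball_lt_top x (r / 2 ^ j)).ne
  have h2 := (ofReal_abs_average_sub_le hpj hfin (integrableOn_of_bounded hfin hum h0 h1)
    (u x)).trans hloc
  have h3 := telescoping hμ hP hCP hum h0 h1 (isUpperGradient_topOff hK hg
    fun γ hγ hn hin => hu γ hγ hn fun t => hKU (hin t)) x hr j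
  have h4 : ∑ i ∈ Finset.range j, ENNReal.ofReal (r / 2 ^ i) *
        (⨍⁻ y in ball x (lam * (r / 2 ^ i)), topOff K g y ^ p ∂μ) ^ (1 / p) =
      ∑ i ∈ Finset.range j, ENNReal.ofReal (r / 2 ^ i) *
        (⨍⁻ y in ball x (lam * (r / 2 ^ i)), g y ^ p ∂μ) ^ (1 / p) := by
    refine Finset.sum_congr rfl fun i _ => ?_
    congr 2
    refine laverage_congr ((ae_restrict_iff' measurableSet_ball).2
      (Eventually.of_forall fun y hy => ?_))
    dsimp only
    rw [topOff_of_mem (hrK (ball_subset_ball ?_ hy))]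
    exact mul_le_mul_of_nonneg_left (div_le_self hr.le (one_le_pow₀ one_le_two)) (by linarith)
  rw [h4] at h3
  rw [← sum_add_dyadicPotential (lam := lam) g x r j, mul_add]
  refine le_trans ?_ (add_le_add h3 h2)
  rw [← ENNReal.ofReal_add (abs_nonneg _) (abs_nonneg _)]
  refine ENNReal.ofReal_le_ofReal ?_
  rw [abs_sub_comm, add_comm, abs_sub_comm (⨍ y in ball x (r / 2 ^ j), u y ∂μ) (u x)]
  rw [abs_sub_comm _ (u x)]
  exact abs_sub_le _ _ _

end Lebesgue

/-! ### Truncation of extended real values. -/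

section Truncation

/-- The truncation of an extended real number to `[0, 1]`. -/
def clamp (e : EReal) : ℝ := (max 0 (min 1 e)).toReal

theorem coe_clamp (e : EReal) : (clamp e : EReal) = max 0 (min 1 e) := by
  refine EReal.coe_toReal (ne_of_lt ?_) (ne_of_gt ?_)
  · exact max_lt EReal.zero_lt_top ((min_le_left _ _).trans_lt (EReal.coe_lt_top 1))
  · exact EReal.bot_lt_zero.trans_le (le_max_left _ _)

theorem clamp_nonneg (e : EReal) : 0 ≤ clamp e := by
  rw [← EReal.coe_le_coe_iff, coe_clamp]; exact le_max_left _ _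

theorem clamp_le_one (e : EReal) : clamp e ≤ 1 := by
  rw [← EReal.coe_le_coe_iff, coe_clamp]; exact max_le zero_le_one (min_le_left _ _)

theorem clamp_of_one_le {e : EReal} (h : 1 ≤ e) : clamp e = 1 := by
  simp [clamp, min_eq_left h]

theorem clamp_of_nonpos {e : EReal} (h : e ≤ 0) : clamp e = 0 := by
  simp [clamp, min_eq_right (h.trans zero_le_one), max_eq_left h]

theorem clamp_coe (a : ℝ) : clamp a = max 0 (min 1 a) := by
  rw [← EReal.coe_eq_coe_iff, coe_clamp, EReal.coe_strictMono.monotone.map_max,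
    EReal.coe_strictMono.monotone.map_min]
  rfl

theorem abs_clamp_sub_le_one (e f : EReal) : |clamp e - clamp f| ≤ 1 :=
  abs_le.2 ⟨by linarith [clamp_nonneg e, clamp_le_one f],
    by linarith [clamp_nonneg f, clamp_le_one e]⟩

theorem abs_clamp_coe_sub_le (a b : ℝ) : |clamp a - clamp b| ≤ |a - b| := by
  rw [clamp_coe, clamp_coe]
  refine (abs_max_sub_max_le_max _ _ _ _).trans ?_
  rw [sub_self, abs_zero, max_eq_right (abs_nonneg _)]
  refine (abs_min_sub_min_le_max _ _ _ _).trans ?_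
  rw [sub_self, abs_zero, max_eq_right (abs_nonneg _)]

theorem measurable_clamp : Measurable clamp :=
  (measurable_const.max (measurable_const.min measurable_id)).ereal_toReal

end Truncation

/-! ### Curves in a subset. -/

section Lift

variable {Y : Type*} [MetricSpace Y] {U : Set Y}

/-- A curve in `U` as a curve of the space `U`. -/
def Curve.lift (γ : Curve Y) (h : ∀ t, γ t ∈ U) : Curve U :=
  ⟨fun t => ⟨γ t, h t⟩, γ.continuous.subtype_mk h⟩

/-- Distances in `U`, hence lengths and arc-length parametrizations, are those of `Y`. -/
theorem Curve.pathIntegral_lift (γ : Curve Y) (h : ∀ t, γ t ∈ U) (g : Y → ℝ≥0∞) :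
    (γ.lift h).pathIntegral (fun x => g x) = γ.pathIntegral g := rfl

end Lift

/-! ### Regularization of weak upper gradients. -/

section Regularization

theorem aemeasurable_of_comap {Y : Type*} [MeasurableSpace Y] {μ : Measure Y} {U : Set Y}
    (hU : MeasurableSet U) {f : U → ℝ}
    (hf : AEMeasurable f (μ.comap ((↑) : U → Y))) {v : Y → ℝ} (hv : ∀ x : U, v x = f x)
    (hv0 : ∀ y ∉ U, v y = 0) : AEMeasurable v μ := by
  classical
  obtain ⟨f', hf', hff'⟩ := hf
  refine ⟨fun y => if h : y ∈ U then f' ⟨y, h⟩ else 0,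
    Measurable.dite hf' measurable_const hU, ?_⟩
  rw [Filter.EventuallyEq, ae_iff] at hff' ⊢
  rw [(MeasurableEmbedding.subtype_coe hU).comap_apply] at hff'
  refine measure_mono_null (fun y hy => ?_) hff'
  by_cases h : y ∈ U
  · refine ⟨⟨y, h⟩, ?_, rfl⟩
    simpa [h, hv ⟨y, h⟩] using hy
  · exact absurd (by simp [h, hv0 y h]) hy

variable {Y : Type*} [MetricSpace Y] [MeasurableSpace Y] [BorelSpace Y] {μ : Measure Y} {p : ℝ}

/-- Truncating a function with a weak upper gradient `g` in `U` yields a function with a lower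
semicontinuous upper gradient, whose energy is almost that of `g`. -/
theorem exists_lowerSemicontinuous_upperGradient (hp : 1 ≤ p) {U : Set Y} (hU : IsOpen U)
    (hUf : μ U ≠ ⊤) {u : U → EReal} (hu : AEMeasurable u (μ.comap ((↑) : U → Y)))
    {g : U → ℝ≥0∞} (hg : IsWeakUpperGradient (μ.comap ((↑) : U → Y)) p u g) {η : ℝ≥0∞}
    (hη : η ≠ 0) :
    ∃ (v : Y → ℝ) (G : Y → ℝ≥0∞) (ε : ℝ), 0 < ε ∧ ε ≤ 1 ∧ LowerSemicontinuous G ∧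
      (∀ y, ENNReal.ofReal ε ≤ G y) ∧ AEMeasurable v μ ∧ (∀ y, 0 ≤ v y) ∧ (∀ y, v y ≤ 1) ∧
      (∀ x : U, v x = clamp (u x)) ∧
      (∀ γ : Curve Y, γ.Rectifiable → γ.Nonconstant → (∀ t, γ t ∈ U) →
        ENNReal.ofReal |v (γ 0) - v (γ 1)| ≤ γ.pathIntegral G) ∧
      ∫⁻ y in U, G y ^ p ∂μ ≤ ∫⁻ x, g x ^ p ∂(μ.comap ((↑) : U → Y)) + η := by
  classical
  have hp0 : 0 < p := by linarith
  obtain ⟨hgm, Γ, hΓ, hΓg⟩ := hg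
  have hη3 : η / 3 ≠ 0 := by simp [hη]
  -- On the exceptional curves `ρ` integrates to at least `1`, which dominates any oscillation of a
  -- function with values in `[0, 1]`.
  obtain ⟨ρ, ⟨hρm, hρ⟩, hρη⟩ : ∃ ρ : U → ℝ≥0∞, (Measurable ρ ∧
      ∀ γ ∈ Γ, Curve.Rectifiable γ → 1 ≤ Curve.pathIntegral γ ρ) ∧
      ∫⁻ y, ρ y ^ p ∂(μ.comap ((↑) : U → Y)) < η / 3 := by
    have h : modulus (μ.comap ((↑) : U → Y)) p Γ < η / 3 := by
      rw [hΓ]; exact pos_iff_ne_zero.2 hη3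
    simpa only [modulus, iInf_lt_iff, exists_prop, mem_ofPred_eq] using h
  -- Since `ε ≤ 1 ≤ p`, one has `ε ^ p ≤ ε ≤ e`, so the floor `ε` costs at most `η / 3`.
  obtain ⟨e, he0, he⟩ := ENNReal.exists_nnreal_pos_mul_lt hUf hη3
  set ε : ℝ := min 1 e with hε
  have hε0 : 0 < ε := lt_min one_pos he0
  have hε1 : ε ≤ 1 := min_le_left _ _
  have hεp : ENNReal.ofReal ε ^ p * μ U ≤ η / 3 := by
    refine le_trans ?_ he.le
    gcongr
    calc ENNReal.ofReal ε ^ p ≤ ENNReal.ofReal ε ^ (1 : ℝ) :=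
          ENNReal.rpow_le_rpow_of_exponent_ge (by simpa using hε1) hp
      _ ≤ e := by
          rw [ENNReal.rpow_one, ← ENNReal.ofReal_coe_nnreal]
          exact ENNReal.ofReal_le_ofReal (min_le_right _ _)
  set f : U → ℝ≥0∞ := fun x => max (max (g x) (ρ x)) (ENNReal.ofReal ε) with hf
  have hfm : Measurable f := (hgm.max hρm).max measurable_const
  -- Vitali–Carathéodory is applied to the `p`-th power, since `p`-energies are compared. The value
  -- off `U` keeps `G ≥ ε` everywhere.
  set F : Y → ℝ≥0∞ := fun y => if h : y ∈ U then f ⟨y, h⟩ ^ p else ENNReal.ofReal ε ^ p with hF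
  have hFm : Measurable F := Measurable.dite (hfm.pow_const p) measurable_const hU.measurableSet
  have hFU : ∀ x : U, F x = f x ^ p := fun x => by simp [hF]
  have : IsFiniteMeasure (μ.restrict U) := ⟨by simpa using hUf.lt_top⟩
  obtain ⟨H, hFH, hHl, hHi⟩ :=
    exists_le_lowerSemicontinuous_lintegral_ge (μ.restrict U) F hFm hη3
  set G : Y → ℝ≥0∞ := fun y => H y ^ (1 / p) with hG
  have hGp : ∀ y, G y ^ p = H y := fun y => by
    rw [hG, ← ENNReal.rpow_mul, one_div_mul_cancel hp0.ne', ENNReal.rpow_one]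
  have hle : ∀ (a : ℝ≥0∞) (y : Y), a ^ p ≤ F y → a ≤ G y := fun a y h => by
    have := ENNReal.rpow_le_rpow (h.trans (hFH y)) (one_div_pos.2 hp0).le
    rwa [← ENNReal.rpow_mul, mul_one_div_cancel hp0.ne', ENNReal.rpow_one] at this
  have hfG : ∀ x : U, f x ≤ G x := fun x => hle _ _ (hFU x).ge
  have hεG : ∀ y, ENNReal.ofReal ε ≤ G y := fun y => by
    by_cases h : y ∈ U
    · exact (le_max_right _ _).trans (hfG ⟨y, h⟩)
    · exact hle _ _ (by simp [hF, h])
  refine ⟨fun y => if h : y ∈ U then clamp (u ⟨y, h⟩) else 0, G, ε, hε0, hε1, ?_, hεG, ?_, ?_, ?_,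
    ?_, ?_, ?_⟩
  · exact (ENNReal.continuous_rpow_const).comp_lowerSemicontinuous hHl
      (ENNReal.monotone_rpow_of_nonneg (one_div_pos.2 hp0).le)
  · exact aemeasurable_of_comap hU.measurableSet (measurable_clamp.comp_aemeasurable hu)
      (fun x => by simp) (fun y hy => by simp [hy])
  · intro y
    dsimp only
    split_ifs
    · exact clamp_nonneg _
    · exact le_rfl
  · intro y
    dsimp only
    split_ifs
    · exact clamp_le_one _
    · exact zero_le_one
  · intro x; simp
  · intro γ hγ hn hin
    simp only [hin, dif_pos]
    have hn' : (γ.lift hin).Nonconstant := by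
      obtain ⟨s, t, hst⟩ := hn
      exact ⟨s, t, fun h => hst (congrArg Subtype.val h)⟩
    have hmono : ∀ h : U → ℝ≥0∞, (∀ x, h x ≤ f x) →
        (γ.lift hin).pathIntegral h ≤ γ.pathIntegral G := by
      intro h hh
      rw [← Curve.pathIntegral_lift γ hin]
      exact lintegral_mono fun t => (hh _).trans (hfG _)
    by_cases hΓγ : γ.lift hin ∈ Γ
    · refine (ENNReal.ofReal_le_ofReal (abs_clamp_sub_le_one _ _)).trans ?_
      rw [ENNReal.ofReal_one]
      exact (hρ _ hΓγ hγ).trans (hmono ρ fun x => (le_max_right _ _).trans (le_max_left _ _))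
    · have hug := hΓg (γ.lift hin) hγ hn' hΓγ
      refine le_trans ?_ (hmono g fun x => (le_max_left _ _).trans (le_max_left _ _))
      change ENNReal.ofReal |clamp (u (γ.lift hin 0)) - clamp (u (γ.lift hin 1))| ≤ _
      generalize ha : u (γ.lift hin 0) = a at *
      generalize hb : u (γ.lift hin 1) = b at *
      obtain ⟨h1, h2⟩ := hug
      rw [ha, hb] at h2
      induction a with
      | bot => rw [h2 (by simp)]; exact le_top
      | top => rw [h2 (by simp)]; exact le_top
      | coe a =>
        induction b with
        | bot => rw [h2 (by simp)]; exact le_top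
        | top => rw [h2 (by simp)]; exact le_top
        | coe b =>
          exact (ENNReal.ofReal_le_ofReal (abs_clamp_coe_sub_le a b)).trans (h1 a b ha hb)
  · simp only [hGp]
    have hfi : ∫⁻ y in U, F y ∂μ = ∫⁻ x, f x ^ p ∂(μ.comap ((↑) : U → Y)) := by
      rw [← lintegral_subtype_comap hU.measurableSet]
      exact lintegral_congr hFU
    have hfp : ∀ x, f x ^ p ≤ g x ^ p + ρ x ^ p + ENNReal.ofReal ε ^ p := by
      intro x
      have hmax : ∀ a b : ℝ≥0∞, (max a b) ^ p ≤ a ^ p + b ^ p := fun a b => by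
        rcases le_total a b with h | h
        · rw [max_eq_right h]; exact le_add_self
        · rw [max_eq_left h]; exact le_self_add
      exact (hmax _ _).trans (add_le_add_left (hmax _ _) _)
    have huniv : μ.comap ((↑) : U → Y) univ = μ U := by
      rw [(MeasurableEmbedding.subtype_coe hU.measurableSet).comap_apply]; simp
    calc ∫⁻ y in U, H y ∂μ ≤ ∫⁻ y in U, F y ∂μ + η / 3 := hHi
      _ ≤ ∫⁻ x, (g x ^ p + ρ x ^ p + ENNReal.ofReal ε ^ p) ∂(μ.comap ((↑) : U → Y)) + η / 3 := by
          rw [hfi]; exact add_le_add_left (lintegral_mono hfp) _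
      _ = ∫⁻ x, g x ^ p ∂(μ.comap ((↑) : U → Y)) + ∫⁻ x, ρ x ^ p ∂(μ.comap ((↑) : U → Y)) +
            ENNReal.ofReal ε ^ p * μ U + η / 3 := by
          rw [lintegral_add_right _ measurable_const, lintegral_add_right _ (hρm.pow_const p),
            lintegral_const, huniv]
      _ ≤ ∫⁻ x, g x ^ p ∂(μ.comap ((↑) : U → Y)) + η / 3 + η / 3 + η / 3 := by gcongr
      _ = _ := by rw [add_assoc, add_assoc, ← add_assoc (η / 3), ENNReal.add_thirds]

end Regularization

/-! ### Codimension content against energy. -/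

section Content

variable {Y : Type*} [MetricSpace Y] [MeasurableSpace Y] {μ : Measure Y} {p θ Cμ CP lam : ℝ}

theorem codimHausdorffContent_le {ι : Type*} [Countable ι] {R : ℝ} {A : Set Y} (x : ι → Y)
    (r : ι → ℝ) (hr : ∀ i, 0 < r i ∧ r i ≤ R) (hA : A ⊆ ⋃ i, ball (x i) (r i)) :
    codimHausdorffContent μ θ R A ≤ ∑' i, μ (ball (x i) (r i)) / ENNReal.ofReal (r i ^ θ) := by
  obtain ⟨e, he⟩ := exists_injective_nat ι
  set E := Equiv.ofInjective e he
  refine sInf_le ⟨range e, fun i => x (E.symm i), fun i => r (E.symm i), fun i => hr _, ?_, ?_⟩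
  · refine hA.trans (iUnion_subset fun i => ?_)
    exact subset_iUnion_of_subset (E i) (by simp)
  · exact (E.symm.tsum_eq (fun i => μ (ball (x i) (r i)) / ENNReal.ofReal (r i ^ θ))).symm

/-- Used to deduce `M ≤ 1`. -/
theorem codimHausdorffContent_le_self {R : ℝ} (hR : 0 < R) {A : Set Y} {x₀ : Y}
    (hA : A ⊆ ball x₀ R) :
    codimHausdorffContent μ θ R A ≤ μ (ball x₀ R) / ENNReal.ofReal (R ^ θ) := by
  have := codimHausdorffContent_le (μ := μ) (θ := θ) (ι := Unit) (R := R) (A := A) (fun _ => x₀)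
    (fun _ => R) (fun _ => ⟨hR, le_rfl⟩)
    (hA.trans (subset_iUnion (fun _ : Unit => ball x₀ R) ()))
  simpa using this

theorem div_ofReal_le_of_le {a b c : ℝ} (ha : 0 < a) (hb : 0 < b) (hc : 0 < c) {m I : ℝ≥0∞}
    (hm : m ≠ 0) (hm' : m ≠ ⊤) (h : ENNReal.ofReal a ≤ ENNReal.ofReal b * (I / m)) :
    m / ENNReal.ofReal c ≤ ENNReal.ofReal (b / (a * c)) * I := by
  rw [← mul_div_assoc, ENNReal.le_div_iff_mul_le (Or.inl hm) (Or.inl hm')] at h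
  refine ENNReal.div_le_of_le_mul ?_
  have h1 : m = ENNReal.ofReal a⁻¹ * (ENNReal.ofReal a * m) := by
    rw [← mul_assoc, ← ENNReal.ofReal_mul (by positivity), inv_mul_cancel₀ ha.ne',
      ENNReal.ofReal_one, one_mul]
  have h2 : ENNReal.ofReal (b / (a * c)) * I * ENNReal.ofReal c =
      ENNReal.ofReal a⁻¹ * (ENNReal.ofReal b * I) := by
    rw [mul_right_comm, ← ENNReal.ofReal_mul (by positivity), ← mul_assoc,
      ← ENNReal.ofReal_mul (by positivity)]
    congr 2
    field_simp
  rw [h2, h1]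
  gcongr

/-- If the dyadic potential is large at a point, then the energy is large in some ball. -/
theorem exists_large_energy (hμ : IsDoublingMeasure μ Cμ) (hp : 0 < p) (hθp : θ < p)
    (hlam : 0 < lam) {G : Y → ℝ≥0∞} {x : Y} {r : ℝ} (hr : 0 < r) {τ : ℝ} (hτ : 0 < τ)
    (hlarge : ENNReal.ofReal (τ / (1 - 2 ^ (θ / p - 1))) < dyadicPotential μ p lam G x r) :
    ∃ k : ℕ, μ (ball x (lam * (r / 2 ^ k))) / ENNReal.ofReal ((r / 2 ^ k) ^ θ) ≤
      ENNReal.ofReal (r ^ (p - θ) / τ ^ p) * ∫⁻ y in ball x (lam * (r / 2 ^ k)), G y ^ p ∂μ := by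
  set q : ℝ := 2 ^ (θ / p - 1) with hq
  have hq0 : 0 < q := by positivity
  have hq1 : q < 1 := Real.rpow_lt_one_of_one_lt_of_neg one_lt_two
    (by rw [sub_neg, div_lt_one hp]; exact hθp)
  -- The weights `τ * q ^ k` sum to `τ / (1 - q)`, so some term of the potential exceeds its weight.
  obtain ⟨k, hk⟩ : ∃ k : ℕ, ENNReal.ofReal (τ * q ^ k) < ENNReal.ofReal (r / 2 ^ k) *
      (⨍⁻ y in ball x (lam * (r / 2 ^ k)), G y ^ p ∂μ) ^ (1 / p) := by
    by_contra! hall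
    refine absurd ((ENNReal.tsum_le_tsum hall).trans_eq ?_) (not_le.2 hlarge)
    rw [← ENNReal.ofReal_tsum_of_nonneg (fun k => by positivity)
      ((summable_geometric_of_lt_one hq0.le hq1).mul_left τ), tsum_mul_left,
      tsum_geometric_of_lt_one hq0.le hq1, div_eq_mul_inv]
  refine ⟨k, ?_⟩
  have hrk : 0 < r / 2 ^ k := by positivity
  have hB0 := (hμ.ball_pos x (show 0 < lam * (r / 2 ^ k) by positivity)).ne'
  have hB := (hμ.ball_lt_top x (lam * (r / 2 ^ k))).ne
  have h := ENNReal.rpow_le_rpow hk.le hp.le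
  rw [ENNReal.mul_rpow_of_nonneg _ _ hp.le, ← ENNReal.rpow_mul, one_div_mul_cancel hp.ne',
    ENNReal.rpow_one, ENNReal.ofReal_rpow_of_pos (by positivity),
    ENNReal.ofReal_rpow_of_pos hrk, setLAverage_eq] at h
  have h2 := div_ofReal_le_of_le (a := (τ * q ^ k) ^ p) (by positivity) (by positivity)
    (show 0 < (r / 2 ^ k) ^ θ by positivity) hB0 hB h
  convert h2 using 3
  -- This is why `q = 2 ^ (θ / p - 1)`: it trades the exponent `p` of the radius for `θ`.
  have hqk : (q ^ k) ^ p = (2 ^ k : ℝ) ^ (θ - p) := by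
    rw [hq, ← Real.rpow_natCast, ← Real.rpow_natCast, ← Real.rpow_mul (by positivity),
      ← Real.rpow_mul (by positivity), ← Real.rpow_mul (by positivity)]
    congr 1
    field_simp
  rw [Real.mul_rpow hτ.le (by positivity), hqk, Real.div_rpow hr.le (by positivity),
    Real.div_rpow hr.le (by positivity), Real.rpow_sub hr, Real.rpow_sub (by positivity)]
  have : 0 < r ^ θ := by positivity
  have : 0 < τ ^ p := by positivity
  have : 0 < ((2 : ℝ) ^ k) ^ θ := by positivity
  have : 0 < ((2 : ℝ) ^ k) ^ p := by positivity
  field_simp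

/-- The content of a set on which the dyadic potential is large is controlled by the energy. -/
theorem codimHausdorffContent_le_energy [OpensMeasurableSpace Y] (hμ : IsDoublingMeasure μ Cμ)
    (hp : 0 < p) (hθ : 0 < θ) (hθp : θ < p) (hlam : 1 ≤ lam) {G : Y → ℝ≥0∞} {R : ℝ} (hR : 0 < R)
    {A U : Set Y} (hAU : ∀ x ∈ A, ball x R ⊆ U) (hU : μ U ≠ ⊤) {τ : ℝ} (hτ : 0 < τ)
    (hlarge : ∀ x ∈ A, ENNReal.ofReal (τ / (1 - 2 ^ (θ / p - 1))) <
      dyadicPotential μ p lam G x (R / (8 * lam))) :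
    codimHausdorffContent μ θ R A ≤
      ENNReal.ofReal Cμ ^ 3 * (ENNReal.ofReal ((R / (8 * lam)) ^ (p - θ) / τ ^ p) *
        ∫⁻ y in U, G y ^ p ∂μ) := by
  classical
  have hlam0 : 0 < lam := by linarith
  -- Vitali's factor `5` fits into `8 = 2 ^ 3`: the enlarged open balls cost `Cμ ^ 3` and have
  -- radius at most `8 * lam * R' = R`, as the content demands.
  set R' := R / (8 * lam) with hR'
  have hR'0 : 0 < R' := by positivity
  have hR'R : 8 * (lam * R') = R := by rw [hR']; field_simp
  have hex : ∀ x : Y, ∃ k : ℕ, x ∈ A →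
      μ (ball x (lam * (R' / 2 ^ k))) / ENNReal.ofReal ((R' / 2 ^ k) ^ θ) ≤
      ENNReal.ofReal (R' ^ (p - θ) / τ ^ p) * ∫⁻ y in ball x (lam * (R' / 2 ^ k)), G y ^ p ∂μ := by
    intro x
    by_cases hx : x ∈ A
    · obtain ⟨k, hk⟩ := exists_large_energy hμ hp hθp hlam0 hR'0 hτ (hlarge x hx)
      exact ⟨k, fun _ => hk⟩
    · exact ⟨0, fun h => absurd h hx⟩
  choose k hk using hex
  set r : Y → ℝ := fun x => R' / 2 ^ k x with hr
  have hr0 : ∀ x, 0 < r x := fun x => by simp only [hr]; positivity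
  have hrR : ∀ x, r x ≤ R' := fun x => div_le_self hR'0.le (one_le_pow₀ one_le_two)
  have hlr : ∀ x, lam * r x ≤ lam * R' := fun x => by gcongr; exact hrR x
  obtain ⟨w, hwA, hwd, hw⟩ := Vitali.exists_disjoint_subfamily_covering_enlargement_closedBall A
    (fun x => x) (fun x => lam * r x) (lam * R') (fun x _ => hlr x) 5 (by norm_num)
  have hballd : Pairwise (Function.onFun Disjoint fun b : w => ball (b : Y) (lam * r b)) := by
    intro b c hbc
    exact (hwd b.2 c.2 (fun h => hbc (Subtype.ext h))).mono ball_subset_closedBall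
      ball_subset_closedBall
  have hballU : ∀ b : w, ball (b : Y) (lam * r b) ⊆ U := fun b =>
    (ball_subset_ball (by linarith [hlr b, mul_pos hlam0 hR'0])).trans (hAU b (hwA b.2))
  -- Disjoint balls of positive measure inside a set of finite measure.
  have hwc : Countable w := by
    have hfin : IsFiniteMeasure (μ.restrict U) := ⟨by simpa using hU.lt_top⟩
    have := Measure.countable_meas_pos_of_disjoint_iUnion (μ := μ.restrict U)
      (fun b : w => measurableSet_ball (x := (b : Y)) (ε := lam * r b)) hballd
    rw [← Set.countable_univ_iff]
    refine this.mono fun b _ => ?_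
    change 0 < μ.restrict U _
    rw [Measure.restrict_apply measurableSet_ball, inter_eq_left.2 (hballU b)]
    exact hμ.ball_pos _ (mul_pos hlam0 (hr0 b))
  refine (codimHausdorffContent_le (fun b : w => (b : Y)) (fun b => 8 * (lam * r b)) (fun b => ?_)
    (fun a ha => ?_)).trans ?_
  · have := mul_pos hlam0 (hr0 b)
    exact ⟨by positivity, by linarith [hlr b]⟩
  · obtain ⟨b, hb, hab⟩ := hw a ha
    refine mem_iUnion.2 ⟨⟨b, hb⟩, ?_⟩
    have h1 := hab (mem_closedBall_self (mul_pos hlam0 (hr0 a)).le)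
    rw [mem_closedBall] at h1
    rw [mem_ball]
    have := mul_pos hlam0 (hr0 b)
    dsimp only at h1 ⊢
    linarith
  calc ∑' b : w, μ (ball (b : Y) (8 * (lam * r b))) / ENNReal.ofReal ((8 * (lam * r b)) ^ θ)
      ≤ ∑' b : w, ENNReal.ofReal Cμ ^ 3 * (ENNReal.ofReal (R' ^ (p - θ) / τ ^ p) *
          ∫⁻ y in ball (b : Y) (lam * r b), G y ^ p ∂μ) := by
        refine ENNReal.tsum_le_tsum fun b => ?_
        have h1 := hμ.ball_two_pow_le (b : Y) (mul_pos hlam0 (hr0 b)) 3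
        have h2 : (2 : ℝ) ^ 3 * (lam * r b) = 8 * (lam * r b) := by norm_num
        rw [h2] at h1
        have h3 : ENNReal.ofReal (r b ^ θ) ≤ ENNReal.ofReal ((8 * (lam * r b)) ^ θ) := by
          refine ENNReal.ofReal_le_ofReal (Real.rpow_le_rpow (hr0 b).le ?_ hθ.le)
          nlinarith [hr0 b]
        refine (ENNReal.div_le_div h1 h3).trans ?_
        rw [mul_div_assoc]
        exact mul_le_mul_right (hk b (hwA b.2)) _
    _ = ENNReal.ofReal Cμ ^ 3 * (ENNReal.ofReal (R' ^ (p - θ) / τ ^ p) *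
          ∑' b : w, ∫⁻ y in ball (b : Y) (lam * r b), G y ^ p ∂μ) := by
        rw [ENNReal.tsum_mul_left, ENNReal.tsum_mul_left]
    _ ≤ _ := by
        rw [← lintegral_iUnion (fun b => measurableSet_ball) hballd]
        gcongr
        exact iUnion_subset hballU

end Content

/-! ### Energy forced by different means. -/

section Capacity

variable {Y : Type*} [MetricSpace Y] [MeasurableSpace Y] [BorelSpace Y]
  {μ : Measure Y} {p θ Cμ CP lam : ℝ}

/-- The energy of a function with different mean values near two points is large. -/
theorem le_energy_of_average (hμ : IsDoublingMeasure μ Cμ) (hP : SupportsPoincare μ p CP lam)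
    (hp : 0 < p) (hCμ : 0 < Cμ) (hCP : 0 < CP) (hlam : 1 ≤ lam) {x₀ : Y} {R : ℝ} (hR : 0 < R)
    {G : Y → ℝ≥0∞} (hG : LowerSemicontinuous G) {v : Y → ℝ} (hvm : AEMeasurable v μ)
    (h0 : ∀ y, 0 ≤ v y) (h1 : ∀ y, v y ≤ 1)
    (hv : ∀ γ : Curve Y, γ.Rectifiable → γ.Nonconstant →
      (∀ t, γ t ∈ ball x₀ (2 * lam * R)) →
      ENNReal.ofReal |v (γ 0) - v (γ 1)| ≤ γ.pathIntegral G)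
    {x y : Y} (hx : x ∈ ball x₀ R) (hy : y ∈ ball x₀ R)
    (hxy : 1 / 3 ≤ |⨍ z in ball x (R / (8 * lam)), v z ∂μ - ⨍ z in ball y (R / (8 * lam)), v z ∂μ|)
    {m : ℕ} (hm : 24 * lam ≤ 2 ^ m) :
    ENNReal.ofReal ((1 / (12 * Cμ ^ m * CP)) ^ p) * (μ (ball x₀ R) / ENNReal.ofReal (R ^ p)) ≤
      ∫⁻ z in ball x₀ (2 * lam * R), G z ^ p ∂μ := by
  have hlam0 : 0 < lam := by linarith
  set U := ball x₀ (2 * lam * R) with hU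
  set T := ∫⁻ z in U, G z ^ p ∂μ with hT
  set R' := R / (8 * lam) with hR'
  have hR'0 : 0 < R' := by positivity
  have hR'R : R' ≤ R := div_le_self hR.le (by linarith)
  have hR'8 : 8 * lam * R' = R := by rw [hR']; field_simp
  rw [mem_ball] at hx hy
  -- The strict bound `r < 2 * R` leaves room for the closed ball `K` inside `U`, while the small
  -- balls about `x` and `y` lie in `ball x₀ r`.
  set r := R + max (dist x x₀) (dist y x₀) with hr
  have hr1 : R ≤ r := by
    have : 0 ≤ max (dist x x₀) (dist y x₀) := dist_nonneg.trans (le_max_left _ _)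
    linarith
  have hr2 : r < 2 * R := by have := max_lt hx hy; linarith
  have hr0 : 0 < r := hR.trans_le hr1
  set K := closedBall x₀ (lam * r) with hK
  have hKU : K ⊆ U := closedBall_subset_ball (by nlinarith)
  have hug := isUpperGradient_topOff (K := K) isClosed_closedBall hG
    (fun γ hγ hn hin => hv γ hγ hn fun t => hKU (hin t))
  set Q : ℝ≥0∞ := (T / μ (ball x₀ R)) ^ (1 / p) with hQ
  have hkey : ∀ z, dist z x₀ < R → dist z x₀ ≤ max (dist x x₀) (dist y x₀) →
      ENNReal.ofReal |⨍ a in ball z R', v a ∂μ - ⨍ a in ball x₀ r, v a ∂μ| ≤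
        ENNReal.ofReal (Cμ ^ m * CP * (2 * R)) * Q := by
    intro z hz hzm
    have hsub : ball z R' ⊆ ball x₀ r := ball_subset_ball' (by linarith)
    -- `ball x₀ r ⊆ ball z (3 * R)`, and `3 * R = 24 * lam * R' ≤ 2 ^ m * R'`.
    have hdoub : μ (ball x₀ r) ≤ ENNReal.ofReal Cμ ^ m * μ (ball z R') := by
      refine (measure_mono (ball_subset_ball' ?_)).trans (hμ.ball_two_pow_le z hR'0 m)
      rw [dist_comm]
      have : 24 * lam * R' ≤ 2 ^ m * R' := by gcongr
      linarith
    refine (poincare_subset hμ hP hCP hvm h0 h1 hug hr0 hsub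
      (hμ.ball_pos z hR'0).ne' hdoub).trans ?_
    rw [ENNReal.ofReal_mul (by positivity), ENNReal.ofReal_mul (by positivity),
      ENNReal.ofReal_pow hCμ.le, mul_assoc, mul_assoc]
    rw [hQ]
    gcongr
    rw [setLAverage_eq]
    refine ENNReal.div_le_div ?_
      (measure_mono (ball_subset_ball (x := x₀) (by nlinarith : R ≤ lam * r)))
    calc ∫⁻ a in ball x₀ (lam * r), topOff K G a ^ p ∂μ
        = ∫⁻ a in ball x₀ (lam * r), G a ^ p ∂μ := by
          refine setLIntegral_congr_fun measurableSet_ball fun a ha => ?_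
          have haK : a ∈ K := ball_subset_closedBall ha
          simp only [topOff_of_mem haK]
      _ ≤ T := 
          lintegral_mono_set ((ball_subset_closedBall (x := x₀) (ε := lam * r)).trans hKU)
  have hsum : ENNReal.ofReal (1 / 3) ≤ ENNReal.ofReal (Cμ ^ m * CP * (4 * R)) * Q := by
    have := add_le_add (hkey x hx (le_max_left _ _)) (hkey y hy (le_max_right _ _))
    rw [← ENNReal.ofReal_add (abs_nonneg _) (abs_nonneg _), ← add_mul,
      ← ENNReal.ofReal_add (by positivity) (by positivity)] at this
    refine le_trans (ENNReal.ofReal_le_ofReal (hxy.trans ?_)) (this.trans_eq ?_)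
    · rw [abs_sub_comm (⨍ a in ball y R', v a ∂μ)]
      exact abs_sub_le _ _ _
    · congr 2; ring
  have hball0 := (hμ.ball_pos x₀ hR).ne'
  have hball := (hμ.ball_lt_top x₀ R).ne
  have h2 := ENNReal.rpow_le_rpow hsum hp.le
  rw [ENNReal.mul_rpow_of_nonneg _ _ hp.le, hQ, ← ENNReal.rpow_mul, one_div_mul_cancel hp.ne',
    ENNReal.rpow_one, ENNReal.ofReal_rpow_of_pos (by positivity),
    ENNReal.ofReal_rpow_of_pos (by positivity)] at h2
  have h3 := div_ofReal_le_of_le (by positivity) (by positivity)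
    (show 0 < R ^ p by positivity) hball0 hball h2
  refine (mul_le_mul_right h3 _).trans (le_of_eq ?_)
  rw [← mul_assoc, ← ENNReal.ofReal_mul (by positivity)]
  have : (1 / (12 * Cμ ^ m * CP)) ^ p *
      ((Cμ ^ m * CP * (4 * R)) ^ p / ((1 / 3) ^ p * R ^ p)) = 1 := by
    rw [← Real.mul_rpow (by positivity) hR.le, ← Real.div_rpow (by positivity) (by positivity),
      ← Real.mul_rpow (by positivity) (by positivity)]
    convert Real.one_rpow p using 2
    field_simp
    norm_num
  rw [this, ENNReal.ofReal_one, one_mul]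

end Capacity

/-! ### The dichotomy and the lower bound. -/

section LowerBound

variable {Y : Type*} [MetricSpace Y] [MeasurableSpace Y] [BorelSpace Y]
  {μ : Measure Y} {p θ Cμ CP lam : ℝ}

/-- Pure rescaling: the powers of `R` cancel, leaving only structural constants. -/
theorem le_energy_of_codimHausdorffContent (hCμ : 0 < Cμ) (hlam : 0 < lam)
    {τ R : ℝ} (hτ : 0 < τ) (hR : 0 < R) {M m T : ℝ≥0∞}
    (h : M * (m / ENNReal.ofReal (R ^ θ)) ≤ ENNReal.ofReal Cμ ^ 3 *
      (ENNReal.ofReal ((R / (8 * lam)) ^ (p - θ) / τ ^ p) * T)) :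
    ENNReal.ofReal (τ ^ p * (8 * lam) ^ (p - θ) / Cμ ^ 3) * (M * (m / ENNReal.ofReal (R ^ p))) ≤
      T := by
  have h1 : m / ENNReal.ofReal (R ^ p) =
      ENNReal.ofReal (R ^ (θ - p)) * (m / ENNReal.ofReal (R ^ θ)) := by
    rw [ENNReal.div_eq_inv_mul, ENNReal.div_eq_inv_mul, ← mul_assoc,
      ← ENNReal.ofReal_inv_of_pos (by positivity), ← ENNReal.ofReal_inv_of_pos (by positivity),
      ← ENNReal.ofReal_mul (by positivity), ← Real.rpow_neg hR.le, ← Real.rpow_neg hR.le,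
      ← Real.rpow_add hR]
    congr 3
    ring
  set c := τ ^ p * (8 * lam) ^ (p - θ) / Cμ ^ 3 with hc
  have hc0 : 0 < c := by positivity
  calc ENNReal.ofReal c * (M * (m / ENNReal.ofReal (R ^ p)))
      = ENNReal.ofReal (c * R ^ (θ - p)) * (M * (m / ENNReal.ofReal (R ^ θ))) := by
        rw [h1, ENNReal.ofReal_mul hc0.le]; ring
    _ ≤ ENNReal.ofReal (c * R ^ (θ - p)) * (ENNReal.ofReal Cμ ^ 3 *
          (ENNReal.ofReal ((R / (8 * lam)) ^ (p - θ) / τ ^ p) * T)) := by gcongr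
    _ = T := by
        rw [← ENNReal.ofReal_pow hCμ.le, ← mul_assoc, ← mul_assoc,
          ← ENNReal.ofReal_mul (by positivity), ← ENNReal.ofReal_mul (by positivity)]
        have : c * R ^ (θ - p) * Cμ ^ 3 * ((R / (8 * lam)) ^ (p - θ) / τ ^ p) = 1 := by
          have e : R ^ (θ - p) = (R ^ (p - θ))⁻¹ := by rw [← Real.rpow_neg hR.le, neg_sub]
          rw [hc, e, Real.div_rpow hR.le (by positivity)]
          have : 0 < R ^ (p - θ) := by positivity
          have : 0 < (8 * lam) ^ (p - θ) := by positivity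
          have : 0 < τ ^ p := by positivity
          field_simp
        rw [this, ENNReal.ofReal_one, one_mul]

/-- The lower bound for the energy of a bounded function with a lower semicontinuous upper
gradient that separates two sets of large content. -/
theorem le_energy_of_separating [LocallyCompactSpace Y] (hμ : IsDoublingMeasure μ Cμ)
    (hP : SupportsPoincare μ p CP lam) (hp : 0 < p) (hθ : 0 < θ) (hθp : θ < p)
    (hCμ : 0 < Cμ) (hCP : 0 < CP) (hlam : 1 ≤ lam) {x₀ : Y} {R : ℝ} (hR : 0 < R)
    {E F : Set Y} (hE : E ⊆ ball x₀ R) (hF : F ⊆ ball x₀ R) {M : ℝ≥0∞}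
    (hM : M * (μ (ball x₀ R) / ENNReal.ofReal (R ^ θ)) ≤
      min (codimHausdorffContent μ θ R E) (codimHausdorffContent μ θ R F))
    {G : Y → ℝ≥0∞} (hG : LowerSemicontinuous G) {ε : ℝ} (hε : 0 < ε) (hε1 : ε ≤ 1)
    (hGε : ∀ y, ENNReal.ofReal ε ≤ G y) {v : Y → ℝ} (hvm : AEMeasurable v μ)
    (h0 : ∀ y, 0 ≤ v y) (h1 : ∀ y, v y ≤ 1) (hvE : ∀ x ∈ E, v x = 1) (hvF : ∀ x ∈ F, v x = 0)
    (hv : ∀ γ : Curve Y, γ.Rectifiable → γ.Nonconstant →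
      (∀ t, γ t ∈ ball x₀ (2 * lam * R)) →
      ENNReal.ofReal |v (γ 0) - v (γ 1)| ≤ γ.pathIntegral G)
    {τ : ℝ} (hτ : 0 < τ) (hτC : Cμ * CP * (τ / (1 - 2 ^ (θ / p - 1))) ≤ 1 / 3)
    {m : ℕ} (hm : 24 * lam ≤ 2 ^ m) :
    ENNReal.ofReal (min (τ ^ p * (8 * lam) ^ (p - θ) / Cμ ^ 3) ((1 / (12 * Cμ ^ m * CP)) ^ p)) *
        (M * (μ (ball x₀ R) / ENNReal.ofReal (R ^ p))) ≤
      ∫⁻ z in ball x₀ (2 * lam * R), G z ^ p ∂μ := by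
  have hlam0 : 0 < lam := by linarith
  set U := ball x₀ (2 * lam * R) with hU
  set c₁ := τ ^ p * (8 * lam) ^ (p - θ) / Cμ ^ 3
  set c₂ := (1 / (12 * Cμ ^ m * CP)) ^ p
  have hUfin := (hμ.ball_lt_top x₀ (2 * lam * R)).ne
  have hlarge : ∀ A ⊆ ball x₀ R, M * (μ (ball x₀ R) / ENNReal.ofReal (R ^ θ)) ≤
      codimHausdorffContent μ θ R A →
      (∀ x ∈ A, ENNReal.ofReal (τ / (1 - 2 ^ (θ / p - 1))) <
        dyadicPotential μ p lam G x (R / (8 * lam))) →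
      ENNReal.ofReal (min c₁ c₂) * (M * (μ (ball x₀ R) / ENNReal.ofReal (R ^ p))) ≤
        ∫⁻ z in U, G z ^ p ∂μ := by
    intro A hA hMA hl
    have hcont := codimHausdorffContent_le_energy hμ hp hθ hθp hlam hR (U := U) (fun x hx => by
      have := hA hx
      rw [mem_ball] at this
      exact ball_subset_ball' (by nlinarith)) hUfin hτ hl
    refine le_trans ?_ (le_energy_of_codimHausdorffContent hCμ hlam0 hτ hR (hMA.trans hcont))
    gcongr
    exact min_le_left _ _
  by_cases hEl : ∀ x ∈ E, ENNReal.ofReal (τ / (1 - 2 ^ (θ / p - 1))) <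
      dyadicPotential μ p lam G x (R / (8 * lam))
  · exact hlarge E hE (hM.trans (min_le_left _ _)) hEl
  by_cases hFl : ∀ x ∈ F, ENNReal.ofReal (τ / (1 - 2 ^ (θ / p - 1))) <
      dyadicPotential μ p lam G x (R / (8 * lam))
  · exact hlarge F hF (hM.trans (min_le_right _ _)) hFl
  -- Each set now has a point of small potential; the mean near `x` is at least `2/3`, the one near
  -- `y` at most `1/3`.
  push Not at hEl hFl
  obtain ⟨x, hxE, hx⟩ := hEl
  obtain ⟨y, hyF, hy⟩ := hFl
  have hR'0 : 0 < R / (8 * lam) := by positivity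
  have hR'8 : lam * (R / (8 * lam)) = R / 8 := by field_simp
  have hclose : ∀ z ∈ ball x₀ R, dyadicPotential μ p lam G z (R / (8 * lam)) ≤
      ENNReal.ofReal (τ / (1 - 2 ^ (θ / p - 1))) →
      |v z - ⨍ a in ball z (R / (8 * lam)), v a ∂μ| ≤ 1 / 3 := by
    intro z hz hzs
    rw [mem_ball] at hz
    have h := ofReal_abs_sub_average_le hμ hP hCP hlam (K := closedBall x₀ (R + R / 8))
      isClosed_closedBall (isOpen_ball (x := x₀) (ε := 2 * lam * R))
      (closedBall_subset_ball (by nlinarith)) hG hε hε1 hGε hvm h0 h1 hv hR'0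
      (x := z) ((ball_subset_ball' (by rw [hR'8]; linarith)).trans ball_subset_closedBall)
    replace h := h.trans (mul_le_mul_right hzs _)
    rw [← ENNReal.ofReal_mul hCμ.le, ← ENNReal.ofReal_mul (by positivity)] at h
    exact (ENNReal.ofReal_le_ofReal_iff (by norm_num)).1 (h.trans (ENNReal.ofReal_le_ofReal hτC))
  have hxc := hclose x (hE hxE) hx
  have hyc := hclose y (hF hyF) hy
  rw [hvE x hxE, abs_le] at hxc
  rw [hvF y hyF, abs_le] at hyc
  have hen := le_energy_of_average hμ hP hp hCμ hCP hlam hR hG hvm h0 h1 hv (hE hxE) (hF hyF)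
    ((by linarith [hxc.2, hyc.1] : (1 : ℝ) / 3 ≤ _).trans (le_abs_self _)) hm
  refine le_trans ?_ hen
  have hb0 := (hμ.ball_pos x₀ hR).ne'
  have hb := (hμ.ball_lt_top x₀ R).ne
  have hM1 : M ≤ 1 := by
    have h := hM.trans ((min_le_left _ _).trans (codimHausdorffContent_le_self hR hE))
    have ha0 : μ (ball x₀ R) / ENNReal.ofReal (R ^ θ) ≠ 0 :=
      (ENNReal.div_pos hb0 ENNReal.ofReal_ne_top).ne'
    have ha : μ (ball x₀ R) / ENNReal.ofReal (R ^ θ) ≠ ⊤ :=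
      ENNReal.div_ne_top hb (ENNReal.ofReal_pos.2 (by positivity)).ne'
    have := (ENNReal.le_div_iff_mul_le (Or.inl ha0) (Or.inl ha)).2 h
    rwa [ENNReal.div_self ha0 ha] at this
  calc ENNReal.ofReal (min c₁ c₂) * (M * (μ (ball x₀ R) / ENNReal.ofReal (R ^ p)))
      ≤ ENNReal.ofReal c₂ * (1 * (μ (ball x₀ R) / ENNReal.ofReal (R ^ p))) := by
        gcongr
        exact min_le_right _ _
    _ = _ := by rw [one_mul]

end LowerBound

end MetricCapacity

end

/-! ### Choice of constants and conclusion. -/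

theorem mainTheorem7 (p θ Cμ CP lam : ℝ) (hp : 1 ≤ p) (hθ : 0 < θ) (hθp : θ < p)
    (hCμ : 1 ≤ Cμ) (hCP : 0 < CP) (hlam : 1 ≤ lam) :
    ∃ c : ℝ, 0 < c ∧
      ∀ (Y : Type*) [MetricSpace Y] [LocallyCompactSpace Y] [MeasurableSpace Y] [BorelSpace Y]
        (μ : Measure Y),
        MetricCapacity.IsDoublingMeasure μ Cμ →
        MetricCapacity.SupportsPoincare μ p CP lam →
        ∀ (x₀ : Y) (R : ℝ), 0 < R →
        ∀ E F : Set Y, E ⊆ ball x₀ R → F ⊆ ball x₀ R → Disjoint E F →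
        ∀ M : ℝ, 0 < M →
          ENNReal.ofReal M * (μ (ball x₀ R) / ENNReal.ofReal (R ^ θ)) ≤
            min (MetricCapacity.codimHausdorffContent μ θ R E)
              (MetricCapacity.codimHausdorffContent μ θ R F) →
          ENNReal.ofReal c * (ENNReal.ofReal M * (μ (ball x₀ R) / ENNReal.ofReal (R ^ p))) ≤
            MetricCapacity.variationalCapacity μ p E F (ball x₀ (2 * lam * R)) := by
  have hp0 : 0 < p := by linarith
  have hCμ0 : 0 < Cμ := by linarith
  have hlam0 : 0 < lam := by linarith
  have hq1 : (2 : ℝ) ^ (θ / p - 1) < 1 := Real.rpow_lt_one_of_one_lt_of_neg one_lt_two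
    (by rw [sub_neg, div_lt_one hp0]; exact hθp)
  have hq : 0 < 1 - (2 : ℝ) ^ (θ / p - 1) := by linarith
  -- Makes the pointwise error `Cμ * CP * (τ / (1 - q))`, with `q = 2 ^ (θ / p - 1)`, equal to
  -- `1/3`; two such errors leave `1/3` of the unit gap between `E` and `F`.
  set τ : ℝ := (1 - 2 ^ (θ / p - 1)) / (3 * Cμ * CP) with hτ
  have hτ0 : 0 < τ := by positivity
  have hτC : Cμ * CP * (τ / (1 - 2 ^ (θ / p - 1))) ≤ 1 / 3 := by
    have h : ∀ a : ℝ, 0 < a → Cμ * CP * (a / (3 * Cμ * CP) / a) = 1 / 3 := fun a ha => by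
      field_simp
    exact (h _ hq).le
  obtain ⟨m, hm⟩ : ∃ m : ℕ, 24 * lam ≤ 2 ^ m :=
    (pow_unbounded_of_one_lt (24 * lam) one_lt_two).imp fun _ h => h.le
  refine ⟨min (τ ^ p * (8 * lam) ^ (p - θ) / Cμ ^ 3) ((1 / (12 * Cμ ^ m * CP)) ^ p),
    by positivity, ?_⟩
  intro Y _ _ _ _ μ hμ hP x₀ R hR E F hE hF _ M _ hM
  refine le_iInf₂ fun u hu => le_iInf₂ fun g hg => ?_
  obtain ⟨⟨hum, -, -⟩, huE, huF⟩ := hu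
  have hRU : R ≤ 2 * lam * R := by nlinarith
  -- `η` absorbs the energy lost in the regularization.
  refine ENNReal.le_of_forall_pos_le_add fun η hη _ => ?_
  obtain ⟨v, G, ε, hε, hε1, hG, hGε, hvm, h0, h1, hvu, hv, hen⟩ :=
    MetricCapacity.exists_lowerSemicontinuous_upperGradient hp isOpen_ball
      (hμ.ball_lt_top x₀ (2 * lam * R)).ne hum hg (ENNReal.coe_ne_zero.2 hη.ne')
  refine le_trans ?_ hen
  exact MetricCapacity.le_energy_of_separating hμ hP hp0 hθ hθp hCμ0 hCP hlam hR hE hF hM hG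
    hε hε1 hGε hvm h0 h1
    (fun x hx => (hvu ⟨x, ball_subset_ball hRU (hE hx)⟩).trans
      (MetricCapacity.clamp_of_one_le (huE _ hx)))
    (fun x hx => (hvu ⟨x, ball_subset_ball hRU (hF hx)⟩).trans
      (MetricCapacity.clamp_of_nonpos (huF _ hx)))
    hv hτ0 hτC hm
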